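/- Let $T$ be a Galton-Watson tree with root $\mathbf 0$, in which the numbers of children of all individuals are independent with the distribution of $\xi$. Once $T$ has been drawn, it is fully revealed to two players, Maker and Breaker, who alternately pick an edge of $T$ that has not been picked before; Maker fixates the edge he picks, Breaker removes the edge she picks. Breaker wins if after finitely many moves $\mathbf 0$ lies in a finite component of the graph obtained from $T$ by deleting the removed edges, and Maker wins otherwise; both play optimally. Let $p$ be the probability that Breaker wins (i.e. has a winning strategy) if Breaker starts, $\bar p$ the probability that Breaker wins if Maker starts (both events are measurable), and let $q=\lim_{n\to\infty}\mathbb P(Z_n=0)$ be the extinction probability, where $Z_n$ is the number of individuals in generation $n$. (a) If $\mathbb P(\xi=k)=s(1-s)^{k-1}$ for $k\ge 1$ (the distribution $\mathrm{Geo}_{\mathbb N}(s)$), then for $s\in(0,\tfrac14]$ $$p=\frac{1-\sqrt{1-4s}}{2(1-s)}\quad\text{and}\quad \bar p=\frac{1-2s-\sqrt{1-4s}}{2(1-s)}=p-\frac{s}{1-s},$$ and $p=\bar p=1$ for $s\in(\tfrac14,1]$. (b) If $\mathbb P(\xi=k)=s(1-s)^{k}$ for $k\ge 0$ (the distribution $\mathrm{Geo}_{\mathbb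 N_0}(s)$), then for $s\in(0,\tfrac15]$ $$p=\frac{1+s-\sqrt{(1-s)(1-5s)}}{2(1-s)}\quad\text{and}\quad \bar p=\frac{1-s-\sqrt{(1-s)(1-5s)}}{2(1-s)}=p-q,$$ and $p=\bar p=1$ for $s\in(\tfrac15,1]$. -/

import Mathlib

open MeasureTheory ProbabilityTheory Filter Topology

namespace MakerBreaker

/-! ### The (1,1) Maker-Breaker game on the edge set of a graph -/

/-- The two players. -/
inductive Player : Type
  | maker
  | breaker

/-- The opponent of a player. -/
def Player.other : Player → Player
  | .maker => .breaker
  | .breaker => .maker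

/-- The player who makes move number `n` (counted from `0`) when `first` starts the game. -/
def turn (first : Player) (n : ℕ) : Player :=
  if Even n then first else first.other

/-- A history of the game: the list of all moves made so far, in chronological order; the entry
`(Player.maker, e)` says that Maker fixated `e`, the entry `(Player.breaker, e)` that Breaker
removed `e`. -/
abbrev History (V : Type*) := List (Player × Sym2 V)

/-- The edges of `G` which are neither fixated nor removed after the history `h`. -/
def available {V : Type*} (G : SimpleGraph V) (h : History V) : Set (Sym2 V) :=
  {e | e ∈ G.edgeSet ∧ ∀ i : Player, (i, e) ∉ h}

/-- The edges that Breaker has removed in the history `h`. -/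
def removed {V : Type*} (h : History V) : Set (Sym2 V) :=
  {e | (Player.breaker, e) ∈ h}

/-- A strategy, for either player, in the game on the (fully known) graph `G`: to every history it
assigns an edge, which has to be an available one as long as there are any. -/
structure Strategy {V : Type*} (G : SimpleGraph V) where
  move : History V → Sym2 V
  legal : ∀ h : History V, (available G h).Nonempty → move h ∈ available G h

open Classical in
/-- The history after `n` moves when `first` starts, Maker plays according to `σ` and Breaker
according to `τ`. (Nothing is played any more once all edges have been played.) -/
noncomputable def play {V : Type*} {G : SimpleGraph V} (first : Player) (σ τ : Strategy G) :
    ℕ → History V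
  | 0 => []
  | n + 1 =>
    if (available G (play first σ τ n)).Nonempty then
      play first σ τ n ++
        [(turn first n,
          match turn first n with
          | .maker => σ.move (play first σ τ n)
          | .breaker => τ.move (play first σ τ n))]
    else play first σ τ n

/-- After the history `h`, the origin `o` lies in a finite component of the graph that is left when
the edges removed by Breaker are deleted. -/
def OriginCutOff {V : Type*} (G : SimpleGraph V) (o : V) (h : History V) : Prop :=
  {v | (G.deleteEdges (removed h)).Reachable o v}.Finite

/-- Breaker wins the game on `G` with origin `o` (under optimal play, with `G` known to both
players) if `first` starts: Breaker has a strategy such that, whatever strategy Maker uses, the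
origin is contained in a finite component after finitely many moves. -/
def BreakerWins {V : Type*} (G : SimpleGraph V) (o : V) (first : Player) : Prop :=
  ∃ τ : Strategy G, ∀ σ : Strategy G, ∃ n : ℕ, OriginCutOff G o (play first σ τ n)

/-! ### Galton-Watson trees

The root is `[]`; the children of the individual `v` are `0 :: v, 1 :: v, …, (c v - 1) :: v`,
where `c v` is the number of children of `v`. -/

/-- `v` is an individual of the family tree with offspring numbers `c`. -/
def IsNode (c : List ℕ → ℕ) : List ℕ → Prop
  | [] => True
  | i :: v => i < c v ∧ IsNode c v

/-- The family tree with offspring numbers `c`: each individual is linked to its children.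
(Labels which do not belong to individuals of the tree are isolated vertices. They are not
connected to the root, and hence play no role in the game with origin `[]`.) -/
def familyTree (c : List ℕ → ℕ) : SimpleGraph (List ℕ) where
  Adj u v := IsNode c u ∧ IsNode c v ∧ ((∃ i, v = i :: u) ∨ (∃ i, u = i :: v))
  symm := ⟨fun _ _ h => ⟨h.2.1, h.1, h.2.2.symm⟩⟩
  loopless := ⟨fun _ h => by
    rcases h.2.2 with ⟨i, hi⟩ | ⟨i, hi⟩ <;> simpa using congrArg List.length hi⟩

/-- The number of individuals in generation `n` of the family tree. -/
noncomputable def generationSize (c : List ℕ → ℕ) (n : ℕ) : ℕ :=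
  {v : List ℕ | IsNode c v ∧ v.length = n}.ncard

/-- The offspring numbers `ξ v` of all (potential) individuals `v` are independent random variables
with common probability mass function `f`. -/
structure IsOffspringFamily {Ω : Type*} [MeasurableSpace Ω] (P : Measure Ω)
    (ξ : List ℕ → Ω → ℕ) (f : ℕ → ℝ) : Prop where
  measurable : ∀ v, Measurable (ξ v)
  indep : iIndepFun ξ P
  law : ∀ v k, P.real {ω | ξ v ω = k} = f k

/-- The event that Breaker wins the game on the instantly revealed Galton-Watson tree with
offspring variables `ξ`, if `first` starts. -/
def breakerWinEvent {Ω : Type*} (ξ : List ℕ → Ω → ℕ) (first : Player) : Set Ω :=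
  {ω | BreakerWins (familyTree fun v => ξ v ω) [] first}

/-- Probability mass function of the geometric distribution on `{1, 2, …}` with parameter `s`. -/
noncomputable def geoPos (s : ℝ) (k : ℕ) : ℝ := if k = 0 then 0 else s * (1 - s) ^ (k - 1)

/-- Probability mass function of the geometric distribution on `{0, 1, 2, …}` with
parameter `s`. -/
noncomputable def geoZero (s : ℝ) (k : ℕ) : ℝ := s * (1 - s) ^ k

end MakerBreaker

/-! The game reduces to a recursion on the tree. Call a vertex lost if Breaker, moving first in its
subtree, cannot cut it off at any finite depth. A vertex is lost exactly when at least two of its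
children are lost: Breaker's single move spoils one of them, and Maker walks on to the other. If at
most one child is lost, Breaker removes the edge to it and from then on answers each move of Maker
where he made it. Offspring numbers are finite, so finitely many finite depths have a common bound
and such a defence ends. This gives `breakerWins_breaker_iff`. When Maker starts, one lost child of
the root already suffices for him (`breakerWins_maker_iff`).

Subtrees of distinct children depend on disjoint families of offspring numbers. Hence `p` is a fixed
point of `G x = E[x^ξ + ξ x^(ξ-1) (1-x)]`; it is the least one in `[0,1]`, being the limit of the
iterates of the monotone `G` from `0` (`IsOffspringFamily.measureReal_cutEvent`). Moreover `pbar = F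
p` with `F` the generating function of `ξ`.

For both geometric laws `G` is rational and `G x = x` becomes a cubic with root `1`. The remaining
quadratic in `(1-s)x` has discriminant `1-4s` or `(1-s)(1-5s)`, whose sign gives the thresholds
`1/4` and `1/5`; its smaller root gives `p`. -/

namespace MakerBreaker

/-! ### Edges of the family tree -/

/-- The edge between `w` and its parent. -/
def parentEdge (w : List ℕ) : Sym2 (List ℕ) := s(w.tail, w)

lemma parentEdge_inj {w w' : List ℕ} (hw : w ≠ []) (h : parentEdge w = parentEdge w') :
    w = w' := by
  unfold parentEdge at h
  rw [Sym2.eq_iff] at h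
  rcases h with h | ⟨h1, h2⟩
  · exact h.2
  · exfalso
    have l1 := congrArg List.length h1
    have l2 := congrArg List.length h2
    have := List.length_pos_iff.2 hw
    simp at l1 l2
    omega

lemma IsNode.of_suffix {c : List ℕ → ℕ} {v w : List ℕ} (hw : IsNode c w) (h : v <:+ w) :
    IsNode c v := by
  induction w with
  | nil => simpa [List.suffix_nil.1 h] using hw
  | cons i w ih =>
    rcases List.suffix_cons_iff.1 h with rfl | h
    · exact hw
    · exact ih hw.2 h

lemma mem_edgeSet_familyTree {c : List ℕ → ℕ} {e : Sym2 (List ℕ)} :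
    e ∈ (familyTree c).edgeSet ↔ ∃ i v, IsNode c (i :: v) ∧ e = parentEdge (i :: v) := by
  induction e with | h a b =>
  rw [SimpleGraph.mem_edgeSet]
  constructor
  · rintro ⟨ha, hb, ⟨i, rfl⟩ | ⟨i, rfl⟩⟩
    · exact ⟨i, a, hb, rfl⟩
    · exact ⟨i, b, ha, Sym2.eq_swap⟩
  · rintro ⟨i, v, hv, h⟩
    rw [← SimpleGraph.mem_edgeSet, h]
    exact ⟨hv.2, hv, Or.inl ⟨i, rfl⟩⟩

lemma mem_available_familyTree {c : List ℕ → ℕ} {h : History (List ℕ)} {i : ℕ} {v : List ℕ} :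
    parentEdge (i :: v) ∈ available (familyTree c) h ↔
      IsNode c (i :: v) ∧ ∀ a, (a, parentEdge (i :: v)) ∉ h := by
  constructor
  · rintro ⟨h1, h2⟩
    obtain ⟨j, u, hu, he⟩ := mem_edgeSet_familyTree.1 h1
    obtain ⟨rfl, rfl⟩ := List.cons.inj (parentEdge_inj (by simp) he)
    exact ⟨hu, h2⟩
  · rintro ⟨h1, h2⟩
    exact ⟨mem_edgeSet_familyTree.2 ⟨i, v, h1, rfl⟩, h2⟩

lemma exists_of_mem_available {c : List ℕ → ℕ} {h : History (List ℕ)} {e : Sym2 (List ℕ)}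
    (he : e ∈ available (familyTree c) h) : ∃ i v, e = parentEdge (i :: v) := by
  obtain ⟨i, v, -, h⟩ := mem_edgeSet_familyTree.1 he.1
  exact ⟨i, v, h⟩

lemma mem_append_parentEdge {h : History (List ℕ)} {a b : Player} {w u : List ℕ} (hw : w ≠ []) :
    (a, parentEdge w) ∈ h ++ [(b, parentEdge u)] ↔ (a, parentEdge w) ∈ h ∨ (a = b ∧ w = u) := by
  simp only [List.mem_append, List.mem_singleton, Prod.mk.injEq]
  constructor
  · rintro (h1 | ⟨h1, h2⟩)
    · exact Or.inl h1
    · exact Or.inr ⟨h1, parentEdge_inj hw h2⟩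
  · rintro (h1 | ⟨h1, rfl⟩)
    · exact Or.inl h1
    · exact Or.inr ⟨h1, rfl⟩

lemma not_cons_suffix (i : ℕ) (v : List ℕ) : ¬ (i :: v) <:+ v := fun h => by
  have := h.length_le
  simp at this

lemma cons_suffix_inj {i j : ℕ} {v w : List ℕ} (hi : (i :: v) <:+ w) (hj : (j :: v) <:+ w) :
    i = j := by
  have := List.suffix_of_suffix_length_le hi hj (by simp)
  have := this.eq_of_length (by simp)
  simpa using this

/-! ### Strategies and plays -/

open Classical in
/-- A strategy which plays a move with the property `Q` whenever there is one. -/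
noncomputable def preferring {V : Type*} [Inhabited V] (G : SimpleGraph V)
    (Q : History V → Sym2 V → Prop) : Strategy G where
  move h :=
    if H : ∃ e, e ∈ available G h ∧ Q h e then H.choose
    else if H' : (available G h).Nonempty then H'.some else s(default, default)
  legal h H' := by
    split_ifs with H
    · exact H.choose_spec.1
    · exact H'.some_mem

lemma preferring_spec {V : Type*} [Inhabited V] {G : SimpleGraph V}
    {Q : History V → Sym2 V → Prop} {h : History V} (H : ∃ e, e ∈ available G h ∧ Q h e) :
    Q h ((preferring G Q).move h) := by
  simp only [preferring, dif_pos H]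
  exact H.choose_spec.2

lemma turn_succ (first : Player) (n : ℕ) : turn first (n + 1) = (turn first n).other := by
  unfold turn
  rcases Nat.even_or_odd n with h | h
  · simp [h, Nat.even_add_one]
  · have : ¬ Even n := Nat.not_even_iff_odd.2 h
    cases first <;> simp [this, Nat.even_add_one, Player.other]

lemma play_succ_maker {V : Type*} {G : SimpleGraph V} {first : Player} {σ τ : Strategy G} {n : ℕ}
    (ha : (available G (play first σ τ n)).Nonempty) (ht : turn first n = .maker) :
    play first σ τ (n + 1) =
      play first σ τ n ++ [(.maker, σ.move (play first σ τ n))] := by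
  rw [play, if_pos ha, ht]

lemma play_succ_breaker {V : Type*} {G : SimpleGraph V} {first : Player} {σ τ : Strategy G} {n : ℕ}
    (ha : (available G (play first σ τ n)).Nonempty) (ht : turn first n = .breaker) :
    play first σ τ (n + 1) =
      play first σ τ n ++ [(.breaker, τ.move (play first σ τ n))] := by
  rw [play, if_pos ha, ht]

/-! ### The recursive description of the winner -/

/-- Moving first in the subtree of `v`, Breaker can separate `v` from its descendants of relative
depth `n`: among the children of `v`, at most one has a subtree in which she cannot do so with
`n - 1` in place of `n`. -/
def CutsWithin (c : List ℕ → ℕ) : ℕ → List ℕ → Prop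
  | 0, _ => False
  | n + 1, v => ∀ i j, i < c v → j < c v → i ≠ j →
      CutsWithin c n (i :: v) ∨ CutsWithin c n (j :: v)

lemma CutsWithin.succ {c : List ℕ → ℕ} {n : ℕ} {v : List ℕ} (h : CutsWithin c n v) :
    CutsWithin c (n + 1) v := by
  induction n generalizing v with
  | zero => exact h.elim
  | succ n ih =>
    intro i j hi hj hij
    exact (h i j hi hj hij).imp ih ih

lemma cutsWithin_mono (c : List ℕ → ℕ) (v : List ℕ) : Monotone fun n => CutsWithin c n v :=
  monotone_nat_of_le_succ fun _ => CutsWithin.succ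

/-- Finitely many children can be treated with a common depth. -/
lemma exists_common_depth (c : List ℕ → ℕ) (v : List ℕ) (k : ℕ) :
    ∃ N, ∀ i < k, (∃ n, CutsWithin c n (i :: v)) → CutsWithin c N (i :: v) := by
  induction k with
  | zero => exact ⟨0, by simp⟩
  | succ k ih =>
    obtain ⟨N, hN⟩ := ih
    by_cases hk : ∃ n, CutsWithin c n (k :: v)
    · obtain ⟨m, hm⟩ := hk
      refine ⟨max N m, fun i hi h => ?_⟩
      rcases Nat.lt_succ_iff_lt_or_eq.1 hi with hi | rfl
      · exact cutsWithin_mono c _ (le_max_left N m) (hN i hi h)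
      · exact cutsWithin_mono c _ (le_max_right N m) hm
    · refine ⟨N, fun i hi h => ?_⟩
      rcases Nat.lt_succ_iff_lt_or_eq.1 hi with hi | rfl
      · exact hN i hi h
      · exact absurd h hk

/-- If Breaker cannot win the subtree of `v` moving first, then she cannot win those of two of the
children of `v` either. -/
lemma exists_two_children {c : List ℕ → ℕ} {v : List ℕ} (h : ¬ ∃ n, CutsWithin c n v) :
    ∃ i j, i < c v ∧ j < c v ∧ i ≠ j ∧ (¬ ∃ n, CutsWithin c n (i :: v)) ∧
      ¬ ∃ n, CutsWithin c n (j :: v) := by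
  by_contra H
  obtain ⟨N, hN⟩ := exists_common_depth c v (c v)
  refine h ⟨N + 1, fun i j hi hj hij => ?_⟩
  by_contra H'
  rw [not_or] at H'
  exact H ⟨i, j, hi, hj, hij, fun h => H'.1 (hN i hi h), fun h => H'.2 (hN j hj h)⟩

/-! ### Maker's strategy -/

lemma reachable_of_not_removed {c : List ℕ → ℕ} {h : History (List ℕ)} {u : List ℕ}
    (hu : IsNode c u) (hr : ∀ w, w ≠ [] → w <:+ u → (Player.breaker, parentEdge w) ∉ h) :
    ((familyTree c).deleteEdges (removed h)).Reachable [] u := by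
  induction u with
  | nil => exact SimpleGraph.Reachable.refl _
  | cons i u ih =>
    refine (ih hu.2 fun w hw hs => hr w hw (hs.trans (List.suffix_cons i u))).trans
      (SimpleGraph.Adj.reachable ?_)
    rw [SimpleGraph.deleteEdges_adj]
    exact ⟨⟨hu.2, hu, Or.inl ⟨i, rfl⟩⟩, hr _ (by simp) List.suffix_rfl⟩

/-- A lost vertex has a lost child, so lost descendants of `v` exist at every depth. All of them
stay connected to the root, hence the component is infinite. -/
lemma not_originCutOff {c : List ℕ → ℕ} {h : History (List ℕ)} {v : List ℕ} (hv : IsNode c v)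
    (hB : ¬ ∃ n, CutsWithin c n v)
    (hr : ∀ w, w ≠ [] → (w <:+ v ∨ v <:+ w) → (Player.breaker, parentEdge w) ∉ h) :
    ¬ OriginCutOff (familyTree c) [] h := by
  have key : ∀ n, ∃ u, IsNode c u ∧ v <:+ u ∧ (¬ ∃ n, CutsWithin c n u) ∧ n ≤ u.length := by
    intro n
    induction n with
    | zero => exact ⟨v, hv, List.suffix_rfl, hB, Nat.zero_le _⟩
    | succ n ih =>
      obtain ⟨u, hu, hs, hb, hl⟩ := ih
      obtain ⟨i, -, hi, -, -, hbi, -⟩ := exists_two_children hb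
      exact ⟨i :: u, ⟨hi, hu⟩, hs.trans (List.suffix_cons i u), hbi, by simpa using hl⟩
  intro hfin
  obtain ⟨M, hM⟩ := (Set.Finite.image List.length hfin).bddAbove
  obtain ⟨u, hu, hs, -, hl⟩ := key (M + 1)
  have : u.length ≤ M := by
    refine hM ⟨u, reachable_of_not_removed hu fun w hw hwu => hr w hw ?_, rfl⟩
    exact List.suffix_or_suffix_of_suffix hwu hs
  omega

/-- With Breaker to move, Maker has fixated the path from the root to a vertex `v` whose subtree is
untouched and which Breaker cannot win moving first. -/
def MakerAhead (c : List ℕ → ℕ) (h : History (List ℕ)) : Prop :=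
  ∃ v, IsNode c v ∧ (¬ ∃ n, CutsWithin c n v) ∧
    (∀ w, w ≠ [] → w <:+ v → (Player.maker, parentEdge w) ∈ h ∧
      (Player.breaker, parentEdge w) ∉ h) ∧
    ∀ i u, v <:+ u → ∀ a, (a, parentEdge (i :: u)) ∉ h

/-- With Maker to move, Maker can fixate one edge to get ahead. -/
def MakerToMoveAhead (c : List ℕ → ℕ) (h : History (List ℕ)) : Prop :=
  ∃ k v, IsNode c (k :: v) ∧ (¬ ∃ n, CutsWithin c n (k :: v)) ∧
    (∀ w, w ≠ [] → w <:+ v → (Player.maker, parentEdge w) ∈ h ∧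
      (Player.breaker, parentEdge w) ∉ h) ∧
    ∀ i u, (k :: v) <:+ (i :: u) → ∀ a, (a, parentEdge (i :: u)) ∉ h

lemma MakerAhead.not_cutOff {c : List ℕ → ℕ} {h : History (List ℕ)} (H : MakerAhead c h) :
    ¬ OriginCutOff (familyTree c) [] h := by
  obtain ⟨v, hv, hB, h1, h2⟩ := H
  refine not_originCutOff hv hB fun w hw hs => ?_
  by_cases hwv : w <:+ v
  · exact (h1 w hw hwv).2
  · have hs := hs.resolve_left hwv
    cases w with
    | nil => exact absurd rfl hw
    | cons i u =>
      rcases List.suffix_cons_iff.1 hs with rfl | hs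
      · exact absurd List.suffix_rfl hwv
      · exact h2 i u hs _

lemma MakerToMoveAhead.not_cutOff {c : List ℕ → ℕ} {h : History (List ℕ)}
    (H : MakerToMoveAhead c h) : ¬ OriginCutOff (familyTree c) [] h := by
  obtain ⟨k, v, hv, hB, h1, h2⟩ := H
  refine not_originCutOff hv hB fun w hw hs => ?_
  cases w with
  | nil => exact absurd rfl hw
  | cons i u =>
    rcases hs with hs | hs
    · rcases List.suffix_cons_iff.1 hs with hs | hs
      · exact h2 i u (hs ▸ List.suffix_rfl) _
      · exact (h1 _ hw hs).2
    · exact h2 i u hs _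

lemma MakerAhead.available_nonempty {c : List ℕ → ℕ} {h : History (List ℕ)}
    (H : MakerAhead c h) : (available (familyTree c) h).Nonempty := by
  obtain ⟨v, hv, hB, h1, h2⟩ := H
  obtain ⟨i, -, hi, -⟩ := exists_two_children hB
  exact ⟨_, mem_available_familyTree.2 ⟨⟨hi, hv⟩, h2 i v List.suffix_rfl⟩⟩

/-- Two lost children of `v` have disjoint branches (the subtree together with the edge above it),
and one edge meets at most one of them. -/
lemma MakerAhead.breaker_move {c : List ℕ → ℕ} {h : History (List ℕ)} (H : MakerAhead c h)
    {e : Sym2 (List ℕ)} (he : e ∈ available (familyTree c) h) :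
    MakerToMoveAhead c (h ++ [(.breaker, e)]) := by
  obtain ⟨v, hv, hB, h1, h2⟩ := H
  obtain ⟨l, x, rfl⟩ := exists_of_mem_available he
  obtain ⟨i, j, hi, hj, hij, hBi, hBj⟩ := exists_two_children hB
  obtain ⟨k, hk, hBk, hs⟩ : ∃ k, k < c v ∧ (¬ ∃ n, CutsWithin c n (k :: v)) ∧
      ¬ (k :: v) <:+ (l :: x) := by
    by_cases hs : (i :: v) <:+ (l :: x)
    · exact ⟨j, hj, hBj, fun h => hij (cons_suffix_inj hs h)⟩
    · exact ⟨i, hi, hBi, hs⟩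
  refine ⟨k, v, ⟨hk, hv⟩, hBk, fun w hw hwv => ?_, fun i u hu a => ?_⟩
  · rw [mem_append_parentEdge hw, mem_append_parentEdge hw]
    refine ⟨Or.inl (h1 w hw hwv).1, ?_⟩
    rintro (h3 | ⟨-, rfl⟩)
    · exact (h1 w hw hwv).2 h3
    · exact he.2 _ (h1 _ hw hwv).1
  · rw [mem_append_parentEdge (by simp)]
    rintro (h3 | ⟨-, h3⟩)
    · refine h2 i u ?_ a h3
      rcases List.suffix_cons_iff.1 hu with hu | hu
      · rw [List.cons.injEq] at hu
        exact hu.2 ▸ List.suffix_rfl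
      · exact (List.suffix_cons k v).trans hu
    · exact hs (h3 ▸ hu)

lemma MakerToMoveAhead.maker_move {c : List ℕ → ℕ} {h : History (List ℕ)}
    (H : MakerToMoveAhead c h) :
    ∃ e, e ∈ available (familyTree c) h ∧ MakerAhead c (h ++ [(.maker, e)]) := by
  obtain ⟨k, v, hv, hB, h1, h2⟩ := H
  refine ⟨parentEdge (k :: v), mem_available_familyTree.2 ⟨hv, h2 k v List.suffix_rfl⟩,
    k :: v, hv, hB, fun w hw hs => ?_, fun i u hu a => ?_⟩
  · rw [mem_append_parentEdge hw, mem_append_parentEdge hw]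
    rcases List.suffix_cons_iff.1 hs with rfl | hs
    · exact ⟨Or.inr ⟨rfl, rfl⟩, by simpa using h2 k v List.suffix_rfl _⟩
    · exact ⟨Or.inl (h1 w hw hs).1, by simpa using (h1 w hw hs).2⟩
  · rw [mem_append_parentEdge (by simp)]
    rintro (h3 | ⟨-, h3⟩)
    · exact h2 i u (hu.trans (List.suffix_cons i u)) a h3
    · rw [← h3] at hu
      exact not_cons_suffix _ _ hu

/-- The two invariants alternate with the turn whatever Breaker plays, and each excludes a cut-off.
-/
lemma not_breakerWins_of_ahead {c : List ℕ → ℕ} {first : Player}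
    (hb : first = .breaker → MakerAhead c []) (hm : first = .maker → MakerToMoveAhead c []) :
    ¬ BreakerWins (familyTree c) [] first := by
  rintro ⟨τ, hτ⟩
  obtain ⟨n, hn⟩ := hτ (preferring _ fun h e => MakerAhead c (h ++ [(.maker, e)]))
  set σ := preferring (familyTree c) fun h e => MakerAhead c (h ++ [(.maker, e)])
  have key : ∀ n, (turn first n = .breaker → MakerAhead c (play first σ τ n)) ∧
      (turn first n = .maker → MakerToMoveAhead c (play first σ τ n)) := by
    intro n
    induction n with
    | zero => simpa [turn, play] using ⟨hb, hm⟩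
    | succ n ih =>
      rw [turn_succ]
      cases ht : turn first n with
      | maker =>
        refine ⟨fun _ => ?_, fun h => by simp [Player.other] at h⟩
        have H := (ih.2 ht).maker_move
        rw [play_succ_maker ⟨_, H.choose_spec.1⟩ ht]
        exact preferring_spec (Q := fun h e => MakerAhead c (h ++ [(.maker, e)])) H
      | breaker =>
        refine ⟨fun h => by simp [Player.other] at h, fun _ => ?_⟩
        have ha := (ih.1 ht).available_nonempty
        rw [play_succ_breaker ha ht]
        exact (ih.1 ht).breaker_move (τ.legal _ ha)
  cases ht : turn first n with
  | maker => exact ((key n).2 ht).not_cutOff hn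
  | breaker => exact ((key n).1 ht).not_cutOff hn

/-! ### Breaker's strategy -/

/-- Maker has fixated the path from the root to the given vertex. -/
def Fixated (h : History (List ℕ)) : List ℕ → Prop
  | [] => True
  | i :: v => (Player.maker, parentEdge (i :: v)) ∈ h ∧ Fixated h v

lemma Fixated.of_suffix {h : History (List ℕ)} {v w : List ℕ} (hw : Fixated h w) (hs : v <:+ w) :
    Fixated h v := by
  induction w with
  | nil => simpa [List.suffix_nil.1 hs] using hw
  | cons i w ih =>
    rcases List.suffix_cons_iff.1 hs with rfl | hs
    · exact hw
    · exact ih hw.2 hs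

/-- A fixated vertex other than the root is determined by the edge above it, which occurs in the
finite list `h`. -/
lemma finite_fixated (h : History (List ℕ)) : {v | Fixated h v}.Finite := by
  have : {v | Fixated h v} ⊆
      insert [] ({w | w ≠ []} ∩ parentEdge ⁻¹' {e | (Player.maker, e) ∈ h}) := by
    rintro (_ | ⟨i, v⟩) hv
    · exact Or.inl rfl
    · exact Or.inr ⟨by simp, hv.1⟩
  refine Set.Finite.subset (Set.Finite.insert _ ?_) this
  refine Set.Finite.of_finite_image (f := parentEdge) (Set.Finite.subset
    ((List.finite_toSet h).image Prod.snd) ?_) fun a ha b _ hab => parentEdge_inj ha.1 hab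
  rintro _ ⟨w, hw, rfl⟩
  exact ⟨_, hw.2, rfl⟩

/-- The edge above `u` is untouched and leads away from the part fixated by Maker. -/
def Frontier (c : List ℕ → ℕ) (h : History (List ℕ)) : List ℕ → Prop
  | [] => False
  | i :: v => IsNode c (i :: v) ∧ Fixated h v ∧ ∀ a, (a, parentEdge (i :: v)) ∉ h

lemma Frontier.not_suffix_fixated {c : List ℕ → ℕ} {h : History (List ℕ)} {u v : List ℕ}
    (hu : Frontier c h u) (hv : Fixated h v) : ¬ u <:+ v := by
  intro hs
  cases u with
  | nil => exact hu
  | cons i u => exact hu.2.2 _ (hv.of_suffix hs).1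

/-- The frontier is an antichain: edges strictly above a frontier edge are fixated, whereas frontier
edges are unplayed. -/
lemma Frontier.eq_of_suffix {c : List ℕ → ℕ} {h : History (List ℕ)} {u u' : List ℕ}
    (hu : Frontier c h u) (hu' : Frontier c h u') (hs : u <:+ u') : u = u' := by
  cases u' with
  | nil => exact hu'.elim
  | cons i v =>
    rcases List.suffix_cons_iff.1 hs with hs | hs
    · exact hs
    · exact absurd hs (hu.not_suffix_fixated hu'.2.1)

lemma Frontier.mem_available {c : List ℕ → ℕ} {h : History (List ℕ)} {u : List ℕ}
    (hu : Frontier c h u) : parentEdge u ∈ available (familyTree c) h := by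
  cases u with
  | nil => exact hu.elim
  | cons i v => exact mem_available_familyTree.2 ⟨hu.1, hu.2.2⟩

/-- Without a frontier, a walk from the root along remaining edges cannot leave the finite set of
fixated vertices. -/
lemma originCutOff_of_frontier_empty {c : List ℕ → ℕ} {h : History (List ℕ)}
    (H : ∀ u, ¬ Frontier c h u) : OriginCutOff (familyTree c) [] h := by
  refine (finite_fixated h).subset ?_
  intro v hv
  have : Relation.ReflTransGen ((familyTree c).deleteEdges (removed h)).Adj [] v :=
    (SimpleGraph.reachable_iff_reflTransGen _ _).1 hv
  induction this with
  | refl => trivial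
  | @tail x y hx hxy ih =>
    have hfx := ih ((SimpleGraph.reachable_iff_reflTransGen _ _).2 hx)
    rw [SimpleGraph.deleteEdges_adj] at hxy
    obtain ⟨⟨h1, h2, ⟨i, rfl⟩ | ⟨i, rfl⟩⟩, h3⟩ := hxy
    · have h4 := H (i :: x)
      refine ⟨?_, hfx⟩
      by_contra h5
      refine h4 ⟨h2, hfx, fun a => ?_⟩
      cases a
      · exact h5
      · exact h3
    · exact hfx.2

/-- The subtree of `u` is untouched, and Breaker, moving first in it, can separate `u` from the
descendants of (absolute) depth `N`. -/
def Harmless (c : List ℕ → ℕ) (N : ℕ) (h : History (List ℕ)) (u : List ℕ) : Prop :=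
  CutsWithin c (N - u.length) u ∧ ∀ i w, u <:+ w → ∀ a, (a, parentEdge (i :: w)) ∉ h

/-- From depth `N` on, the truncated difference is `0`, and `CutsWithin c 0` is false. -/
lemma Harmless.length_lt {c : List ℕ → ℕ} {N : ℕ} {h : History (List ℕ)} {u : List ℕ}
    (H : Harmless c N h u) : u.length < N := by
  by_contra hl
  have := H.1
  rw [Nat.sub_eq_zero_of_le (not_lt.1 hl)] at this
  exact this

/-- With Breaker to move, the frontier has at most one dangerous vertex. -/
def BreakerCanDefend (c : List ℕ → ℕ) (N : ℕ) (h : History (List ℕ)) : Prop :=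
  (∀ u, Frontier c h u → u.length ≤ N) ∧
    ∀ u u', Frontier c h u → Frontier c h u' → ¬ Harmless c N h u → ¬ Harmless c N h u' → u = u'

lemma fixated_append_breaker {h : History (List ℕ)} {e : Sym2 (List ℕ)} {v : List ℕ}
    (hv : Fixated (h ++ [(.breaker, e)]) v) : Fixated h v := by
  induction v with
  | nil => trivial
  | cons i v ih => exact ⟨by simpa using hv.1, ih hv.2⟩

/-- Breaker removes the edge above the dangerous frontier vertex, or any frontier edge if there is
none. The other frontier subtrees stay untouched because the frontier is an antichain. -/
lemma BreakerCanDefend.breaker_move {c : List ℕ → ℕ} {N : ℕ} {h : History (List ℕ)}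
    (H : BreakerCanDefend c N h) (hf : ∃ u, Frontier c h u) :
    ∃ u, Frontier c h u ∧
      ∀ u', Frontier c (h ++ [(.breaker, parentEdge u)]) u' →
        Harmless c N (h ++ [(.breaker, parentEdge u)]) u' := by
  obtain ⟨u, hu, hb⟩ : ∃ u, Frontier c h u ∧
      ∀ u', Frontier c h u' → u' ≠ u → Harmless c N h u' := by
    by_cases hb : ∃ u, Frontier c h u ∧ ¬ Harmless c N h u
    · obtain ⟨u, hu, hg⟩ := hb
      refine ⟨u, hu, fun u' hu' hne => ?_⟩
      by_contra hg'
      exact hne (H.2 u' u hu' hu hg' hg)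
    · obtain ⟨u, hu⟩ := hf
      refine ⟨u, hu, fun u' hu' _ => ?_⟩
      by_contra hg'
      exact hb ⟨u', hu', hg'⟩
  refine ⟨u, hu, fun u' hu' => ?_⟩
  have hf' : Frontier c h u' ∧ u' ≠ u := by
    cases u' with
    | nil => exact hu'.elim
    | cons i v =>
      refine ⟨⟨hu'.1, fixated_append_breaker hu'.2.1, fun a ha => ?_⟩, ?_⟩
      · exact hu'.2.2 a (List.mem_append_left _ ha)
      · rintro rfl
        exact hu'.2.2 .breaker (by simp)
  have hg := hb u' hf'.1 hf'.2
  refine ⟨hg.1, fun i w hw a => ?_⟩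
  rw [mem_append_parentEdge (by simp)]
  rintro (h1 | ⟨-, rfl⟩)
  · exact hg.2 i w hw a h1
  · exact hf'.2 (hf'.1.eq_of_suffix hu (hw.trans (List.suffix_cons i w)))

lemma fixated_append_maker {h : History (List ℕ)} {w v : List ℕ}
    (hv : Fixated (h ++ [(.maker, parentEdge w)]) v) (hs : ¬ w <:+ v) : Fixated h v := by
  induction v with
  | nil => trivial
  | cons i v ih =>
    refine ⟨?_, ih hv.2 fun h => hs (h.trans (List.suffix_cons i v))⟩
    refine ((mem_append_parentEdge (by simp)).1 hv.1).resolve_right ?_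
    rintro ⟨-, rfl⟩
    exact hs List.suffix_rfl

/-- After Maker's move `w`, a frontier vertex was a frontier vertex before, or is a child of `w`,
and `w` was a frontier vertex. -/
lemma frontier_append_maker {c : List ℕ → ℕ} {N : ℕ} {h : History (List ℕ)} {w u : List ℕ}
    (H : ∀ u, Frontier c h u → Harmless c N h u)
    (hw : parentEdge w ∈ available (familyTree c) h)
    (hu : Frontier c (h ++ [(.maker, parentEdge w)]) u) :
    u ≠ w ∧ (Frontier c h u ∨ (Frontier c h w ∧ ∃ j, j < c w ∧ u = j :: w)) := by
  obtain ⟨l, x, hlx⟩ := exists_of_mem_available hw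
  have hwne : w ≠ [] := by
    rintro rfl
    have := parentEdge_inj (by simp) hlx.symm
    simp at this
  obtain rfl := parentEdge_inj hwne hlx
  cases u with
  | nil => exact hu.elim
  | cons j y =>
    have hne : j :: y ≠ l :: x := fun h1 => hu.2.2 .maker (by rw [h1]; simp)
    refine ⟨hne, ?_⟩
    by_cases hs : (l :: x) <:+ y
    · right
      have hfw := hu.2.1.of_suffix hs
      have hw' := mem_available_familyTree.1 hw
      have hF : Frontier c h (l :: x) :=
        ⟨hw'.1, fixated_append_maker hfw.2 (not_cons_suffix _ _), hw'.2⟩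
      refine ⟨hF, j, ?_⟩
      -- If `y` were strictly below `w`, its fixated edge would predate the present move, although
      -- the subtree of the harmless `w` was untouched.
      obtain rfl : y = l :: x := by
        by_contra hne'
        cases y with
        | nil => simp at hs
        | cons k z =>
          rcases List.suffix_cons_iff.1 hs with hs | hs
          · exact hne' hs.symm
          · refine (H _ hF).2 k z hs .maker ?_
            exact ((mem_append_parentEdge (by simp)).1 hu.2.1.1).resolve_right
              fun h1 => hne' h1.2
      exact ⟨hu.1.1, rfl⟩
    · left
      exact ⟨hu.1, fixated_append_maker hu.2.1 hs,
        fun a ha => hu.2.2 a (List.mem_append_left _ ha)⟩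

/-- An old frontier vertex turns dangerous only if Maker plays below it, and by the antichain
property this happens to at most one. If he fixates a frontier edge `w`, no other old vertex is
affected, and among the children of `w`, which join the frontier, `CutsWithin` allows at most one
dangerous vertex. -/
lemma breakerCanDefend_append_maker {c : List ℕ → ℕ} {N : ℕ} {h : History (List ℕ)}
    (H : ∀ u, Frontier c h u → Harmless c N h u) {e : Sym2 (List ℕ)}
    (he : e ∈ available (familyTree c) h) :
    BreakerCanDefend c N (h ++ [(.maker, e)]) := by
  obtain ⟨l, x, rfl⟩ := exists_of_mem_available he
  set w := l :: x with hwdef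
  set h' := h ++ [(Player.maker, parentEdge w)] with hh'
  have old : ∀ u, Frontier c h u → ¬ Harmless c N h' u → u <:+ w := by
    intro u hu hb
    by_contra hs
    refine hb ⟨(H u hu).1, fun i y hy a => ?_⟩
    rw [hh', mem_append_parentEdge (by simp)]
    rintro (h1 | ⟨-, h1⟩)
    · exact (H u hu).2 i y hy a h1
    · exact hs (h1 ▸ hy.trans (List.suffix_cons i y))
  have mixed : ∀ u u', u ≠ w → Frontier c h u → ¬ Harmless c N h' u → Frontier c h w →
      u = u' := by
    intro u u' hne hu hb hw
    exact absurd (hu.eq_of_suffix hw (old u hu hb)) hne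
  refine ⟨fun u hu => ?_, fun u u' hu hu' hb hb' => ?_⟩
  · obtain ⟨-, hu | ⟨hw, j, -, rfl⟩⟩ := frontier_append_maker H he hu
    · exact (H u hu).length_lt.le
    · exact (H w hw).length_lt
  · obtain ⟨hne, h1⟩ := frontier_append_maker H he hu
    obtain ⟨hne', h1'⟩ := frontier_append_maker H he hu'
    rcases h1 with h1 | ⟨hw, j, hj, rfl⟩
    · rcases h1' with h1' | ⟨hw, j, hj, rfl⟩
      · rcases List.suffix_or_suffix_of_suffix (old u h1 hb) (old u' h1' hb') with hs | hs
        · exact h1.eq_of_suffix h1' hs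
        · exact (h1'.eq_of_suffix h1 hs).symm
      · exact mixed _ _ hne h1 hb hw
    · rcases h1' with h1' | ⟨-, j', hj', rfl⟩
      · exact (mixed _ _ hne' h1' hb' hw).symm
      · by_contra hjj
        have hlt := (H w hw).length_lt
        -- The depth budget of `w` is a successor, so `CutsWithin` unfolds to its children, whose
        -- budget is one less.
        have hsub : N - w.length = (N - (w.length + 1)) + 1 := by omega
        have hc := (H w hw).1
        rw [hsub] at hc
        have untouched : ∀ k i y, (k :: w) <:+ y → ∀ a, (a, parentEdge (i :: y)) ∉ h' := by
          intro k i y hy a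
          rw [hh', mem_append_parentEdge (by simp)]
          rintro (h2 | ⟨-, h2⟩)
          · exact (H w hw).2 i y ((List.suffix_cons k w).trans hy) a h2
          · have := hy.length_le
            have h3 := congrArg List.length h2
            simp at this h3
            omega
        rcases hc j j' hj hj' (fun h => hjj (by rw [h])) with h2 | h2
        · exact hb ⟨h2, untouched j⟩
        · exact hb' ⟨h2, untouched j'⟩

lemma finite_nodes_length_le (c : List ℕ → ℕ) (N : ℕ) :
    {v | IsNode c v ∧ v.length ≤ N}.Finite := by
  induction N with
  | zero =>
    refine (Set.finite_singleton []).subset ?_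
    rintro v ⟨-, hv⟩
    exact List.length_eq_zero_iff.1 (Nat.le_zero.1 hv)
  | succ N ih =>
    refine Set.Finite.subset (Set.Finite.insert [] (Set.Finite.biUnion ih fun v _ =>
      (Set.finite_lt_nat (c v)).image fun i => i :: v)) ?_
    rintro (_ | ⟨i, v⟩) ⟨h1, h2⟩
    · exact Or.inl rfl
    · refine Or.inr (Set.mem_biUnion (x := v) ⟨h1.2, by simpa using h2⟩ ⟨i, h1.1, rfl⟩)

/-- The edges up to depth `N` that have not been played. -/
def untouchedUpTo (c : List ℕ → ℕ) (N : ℕ) (h : History (List ℕ)) : Set (List ℕ) :=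
  {w | (IsNode c w ∧ w.length ≤ N) ∧ ∀ a, (a, parentEdge w) ∉ h}

/-- The moves Breaker looks for. -/
def DefendingMove (c : List ℕ → ℕ) (N : ℕ) (h : History (List ℕ)) (e : Sym2 (List ℕ)) : Prop :=
  ∃ u, e = parentEdge u ∧ u ∈ untouchedUpTo c N h ∧
    ∀ u', Frontier c (h ++ [(.breaker, e)]) u' → Harmless c N (h ++ [(.breaker, e)]) u'

lemma BreakerCanDefend.exists_defendingMove {c : List ℕ → ℕ} {N : ℕ} {h : History (List ℕ)}
    (H : BreakerCanDefend c N h) (hf : ∃ u, Frontier c h u) :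
    ∃ e, e ∈ available (familyTree c) h ∧ DefendingMove c N h e := by
  obtain ⟨u, hu, hu'⟩ := H.breaker_move hf
  refine ⟨_, hu.mem_available, u, rfl, ?_, hu'⟩
  cases u with
  | nil => exact hu.elim
  | cons i v => exact ⟨⟨hu.1, H.1 _ hu⟩, hu.2.2⟩

/-- Termination: every defending move uses up an edge of depth at most `N`, and there are finitely
many. So the frontier empties or the available edges run out, and either way the root is cut off. -/
lemma exists_cutOff_of_canDefend {c : List ℕ → ℕ} {N : ℕ} {first : Player}
    (σ : Strategy (familyTree c)) (m n : ℕ) (ht : turn first n = .breaker)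
    (H : BreakerCanDefend c N
      (play first σ (preferring (familyTree c) (DefendingMove c N)) n))
    (hm : (untouchedUpTo c N
      (play first σ (preferring (familyTree c) (DefendingMove c N)) n)).ncard ≤ m) :
    ∃ n, OriginCutOff (familyTree c) []
      (play first σ (preferring (familyTree c) (DefendingMove c N)) n) := by
  set τ := preferring (familyTree c) (DefendingMove c N) with hτ
  induction m using Nat.strong_induction_on generalizing n with
  | _ m ih =>
  by_cases hf : ∃ u, Frontier c (play first σ τ n) u
  swap
  · exact ⟨n, originCutOff_of_frontier_empty (not_exists.1 hf)⟩
  have hmove := H.exists_defendingMove hf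
  have hav : (available (familyTree c) (play first σ τ n)).Nonempty := ⟨_, hmove.choose_spec.1⟩
  have hplay := play_succ_breaker (σ := σ) (τ := τ) hav ht
  obtain ⟨u, hu1, hu2, hu3⟩ : DefendingMove c N (play first σ τ n) (τ.move (play first σ τ n)) :=
    preferring_spec hmove
  rw [← hplay] at hu3
  by_cases hav' : (available (familyTree c) (play first σ τ (n + 1))).Nonempty
  swap
  · exact ⟨n + 1, originCutOff_of_frontier_empty fun u hu => hav' ⟨_, hu.mem_available⟩⟩
  have ht' : turn first (n + 1) = .maker := by rw [turn_succ, ht]; rfl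
  have hplay' := play_succ_maker (σ := σ) (τ := τ) hav' ht'
  have hlt : (untouchedUpTo c N (play first σ τ (n + 2))).ncard <
      (untouchedUpTo c N (play first σ τ n)).ncard := by
    refine Set.ncard_lt_ncard ⟨?_, fun hsub => ?_⟩
      ((finite_nodes_length_le c N).subset fun w hw => hw.1)
    · rintro w ⟨hw, hw'⟩
      refine ⟨hw, fun a ha => hw' a ?_⟩
      rw [hplay', hplay]
      simp [ha]
    · refine (hsub hu2).2 .breaker ?_
      rw [hplay', hplay, hu1]
      simp
  refine ih _ (lt_of_lt_of_le hlt hm) (n + 2) ?_ ?_ le_rfl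
  · rw [turn_succ, ht']; rfl
  · rw [hplay']
    exact breakerCanDefend_append_maker hu3 (σ.legal _ hav')

lemma frontier_nil {c : List ℕ → ℕ} {u : List ℕ} (hu : Frontier c [] u) :
    ∃ i, i < c [] ∧ u = [i] := by
  match u, hu with
  | [i], hu => exact ⟨i, hu.1.1, rfl⟩
  | i :: j :: v, hu => exact absurd hu.2.1.1 (by simp)

lemma harmless_nil {c : List ℕ → ℕ} {N i : ℕ} (h : CutsWithin c N [i]) :
    Harmless c (N + 1) [] [i] :=
  ⟨by simpa using h, by simp⟩

theorem breakerWins_breaker_iff (c : List ℕ → ℕ) :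
    BreakerWins (familyTree c) [] .breaker ↔ ∃ n, CutsWithin c n [] := by
  constructor
  · intro h
    by_contra hB
    refine not_breakerWins_of_ahead (fun _ => ?_) (fun h => by simp at h) h
    exact ⟨[], trivial, hB, fun w hw hs => absurd (List.suffix_nil.1 hs) hw, by simp⟩
  · rintro ⟨N, hN⟩
    cases N with
    | zero => exact hN.elim
    | succ N =>
    -- Children of the root have depth `1`, so the horizon `N + 1` leaves them the budget `N` that
    -- `hN` speaks of.
    refine ⟨preferring _ (DefendingMove c (N + 1)), fun σ => ?_⟩
    refine exists_cutOff_of_canDefend σ _ 0 (by simp [turn]) ⟨fun u hu => ?_, ?_⟩ le_rfl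
    · obtain ⟨i, -, rfl⟩ := frontier_nil hu
      simp
    · intro u u' hu hu' hb hb'
      obtain ⟨i, hi, rfl⟩ := frontier_nil hu
      obtain ⟨j, hj, rfl⟩ := frontier_nil hu'
      by_contra hij
      rcases hN i j hi hj (fun h => hij (by rw [h])) with h | h
      · exact hb (harmless_nil h)
      · exact hb' (harmless_nil h)

/-- Maker's opening move can exploit any one lost child. If there is none, all frontier vertices are
harmless before it, and Breaker can defend after it. -/
theorem breakerWins_maker_iff (c : List ℕ → ℕ) :
    BreakerWins (familyTree c) [] .maker ↔ ∀ i < c [], ∃ n, CutsWithin c n [i] := by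
  constructor
  · intro h
    by_contra hB
    push Not at hB
    obtain ⟨i, hi, hB⟩ := hB
    refine not_breakerWins_of_ahead (fun h => by simp at h) (fun _ => ?_) h
    exact ⟨i, [], ⟨hi, trivial⟩, by simpa using hB,
      fun w hw hs => absurd (List.suffix_nil.1 hs) hw, by simp⟩
  · intro h
    obtain ⟨N, hN⟩ := exists_common_depth c [] (c [])
    refine ⟨preferring _ (DefendingMove c (N + 1)), fun σ => ?_⟩
    set τ := preferring (familyTree c) (DefendingMove c (N + 1))
    have h0 : ∀ u, Frontier c [] u → Harmless c (N + 1) [] u := by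
      intro u hu
      obtain ⟨i, hi, rfl⟩ := frontier_nil hu
      exact harmless_nil (hN i hi (h i hi))
    by_cases hav : (available (familyTree c) []).Nonempty
    swap
    · exact ⟨0, originCutOff_of_frontier_empty fun u hu => hav ⟨_, hu.mem_available⟩⟩
    have hplay := play_succ_maker (first := .maker) (σ := σ) (τ := τ) (n := 0) hav (by simp [turn])
    refine exists_cutOff_of_canDefend σ _ 1 (by simp [turn, Player.other]) ?_ le_rfl
    rw [hplay]
    exact breakerCanDefend_append_maker h0 (σ.legal _ hav)

/-! ### Extinction -/

/-- The vertex `v` has no descendants of relative depth `n`. -/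
def DiesWithin (c : List ℕ → ℕ) : ℕ → List ℕ → Prop
  | 0, _ => False
  | n + 1, v => ∀ i, i < c v → DiesWithin c n (i :: v)

lemma DiesWithin.succ {c : List ℕ → ℕ} {n : ℕ} {v : List ℕ} (h : DiesWithin c n v) :
    DiesWithin c (n + 1) v := by
  induction n generalizing v with
  | zero => exact h.elim
  | succ n ih => exact fun i hi => ih (h i hi)

lemma exists_cons_suffix {v w : List ℕ} (h : v <:+ w) (hne : v ≠ w) : ∃ i, (i :: v) <:+ w := by
  obtain ⟨l, rfl⟩ := h
  rcases List.eq_nil_or_concat l with rfl | ⟨l, i, rfl⟩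
  · simp at hne
  · exact ⟨i, l, by simp⟩

lemma diesWithin_iff {c : List ℕ → ℕ} {n : ℕ} {v : List ℕ} (hv : IsNode c v) :
    DiesWithin c n v ↔ ¬ ∃ w, IsNode c w ∧ v <:+ w ∧ w.length = v.length + n := by
  induction n generalizing v with
  | zero => exact ⟨fun h => h.elim, fun h => h ⟨v, hv, List.suffix_rfl, rfl⟩⟩
  | succ n ih =>
    constructor
    · rintro h ⟨w, hw, hs, hl⟩
      obtain ⟨i, hi⟩ := exists_cons_suffix hs (by rintro rfl; omega)
      have hn := hw.of_suffix hi
      exact (ih hn).1 (h i hn.1) ⟨w, hw, hi, by simp; omega⟩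
    · intro h i hi
      refine (ih (show IsNode c (i :: v) from ⟨hi, hv⟩)).2 ?_
      rintro ⟨w, hw, hs, hl⟩
      exact h ⟨w, hw, (List.suffix_cons i v).trans hs, by simp at hl; omega⟩

lemma generationSize_eq_zero_iff (c : List ℕ → ℕ) (n : ℕ) :
    generationSize c n = 0 ↔ DiesWithin c n [] := by
  -- `ncard` also vanishes on infinite sets, so finiteness of the generation is needed.
  rw [diesWithin_iff (show IsNode c [] from trivial), generationSize, Set.ncard_eq_zero
    ((finite_nodes_length_le c n).subset fun v hv => ⟨hv.1, hv.2.le⟩),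
    Set.eq_empty_iff_forall_notMem]
  simp

/-! ### Events that depend on parts of the family tree -/

section Events

variable {Ω : Type*}

/-- The σ-algebra generated by the offspring numbers of the individuals in `S`. -/
abbrev offspringSigma (ξ : List ℕ → Ω → ℕ) (S : Set (List ℕ)) : MeasurableSpace Ω :=
  ⨆ w ∈ S, MeasurableSpace.comap (ξ w) ⊤

lemma offspringSigma_mono (ξ : List ℕ → Ω → ℕ) {S T : Set (List ℕ)} (h : S ⊆ T) :
    offspringSigma ξ S ≤ offspringSigma ξ T :=
  biSup_mono h

lemma offspringSigma_le [m : MeasurableSpace Ω] {ξ : List ℕ → Ω → ℕ} (hξ : ∀ v, Measurable (ξ v))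
    (S : Set (List ℕ)) : offspringSigma ξ S ≤ m :=
  iSup₂_le fun w _ => (hξ w).comap_le

lemma measurableSet_offspring_eq (ξ : List ℕ → Ω → ℕ) {S : Set (List ℕ)} {v : List ℕ}
    (hv : v ∈ S) (k : ℕ) : MeasurableSet[offspringSigma ξ S] {ω | ξ v ω = k} :=
  (le_iSup₂ (f := fun w (_ : w ∈ S) => MeasurableSpace.comap (ξ w) ⊤) v hv) _
    ⟨{k}, trivial, rfl⟩

/-- All descendants of `v`, including `v`. -/
def descendants (v : List ℕ) : Set (List ℕ) := {w | v <:+ w}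

/-- All descendants of the children `0 :: v, …, (k - 1) :: v`. -/
def descendantsLT (v : List ℕ) (k : ℕ) : Set (List ℕ) := {w | ∃ i < k, (i :: v) <:+ w}

/-- All descendants of `v`, excluding `v`. -/
def properDescendants (v : List ℕ) : Set (List ℕ) := {w | ∃ i, (i :: v) <:+ w}

lemma descendants_child_subset (v : List ℕ) {i k : ℕ} (h : i < k) :
    descendants (i :: v) ⊆ descendantsLT v k := fun _ hw => ⟨i, h, hw⟩

lemma descendantsLT_mono (v : List ℕ) {j k : ℕ} (h : j ≤ k) :
    descendantsLT v j ⊆ descendantsLT v k := fun _ ⟨i, hi, hw⟩ => ⟨i, hi.trans_le h, hw⟩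

lemma descendantsLT_subset (v : List ℕ) (k : ℕ) :
    descendantsLT v k ⊆ properDescendants v := fun _ ⟨i, _, hw⟩ => ⟨i, hw⟩

lemma properDescendants_subset (v : List ℕ) : properDescendants v ⊆ descendants v :=
  fun _ ⟨i, hw⟩ => (List.suffix_cons i v).trans hw

lemma disjoint_descendantsLT (v : List ℕ) (k : ℕ) :
    Disjoint (descendantsLT v k) (descendants (k :: v)) := by
  rw [Set.disjoint_left]
  rintro w ⟨i, hi, hw⟩ hw'
  exact hi.ne (cons_suffix_inj hw hw')

lemma disjoint_singleton_properDescendants (v : List ℕ) :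
    Disjoint {v} (properDescendants v) := by
  rw [Set.disjoint_singleton_left]
  rintro ⟨i, hi⟩
  exact not_cons_suffix i v hi

/-- `E` occurs at each of the first `k` children of `v`. -/
def allChildren (E : List ℕ → Set Ω) (v : List ℕ) (k : ℕ) : Set Ω :=
  {ω | ∀ i, i < k → ω ∈ E (i :: v)}

/-- `E` fails at one of the first `k` children of `v` at most. -/
def allButOneChild (E : List ℕ → Set Ω) (v : List ℕ) (k : ℕ) : Set Ω :=
  {ω | ∀ i j, i < k → j < k → i ≠ j → ω ∈ E (i :: v) ∨ ω ∈ E (j :: v)}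

lemma allChildren_succ (E : List ℕ → Set Ω) (v : List ℕ) (k : ℕ) :
    allChildren E v (k + 1) = allChildren E v k ∩ E (k :: v) := by
  ext ω
  simp only [allChildren, Set.mem_ofPred_eq, Set.mem_inter_iff]
  exact Nat.forall_lt_succ_right

/-- The last child either satisfies `E` or is the one permitted exception. The two cases are
disjoint and each is an intersection of independent events, as the computation of the probability
requires. -/
lemma allButOneChild_succ (E : List ℕ → Set Ω) (v : List ℕ) (k : ℕ) :
    allButOneChild E v (k + 1) =
      (allButOneChild E v k ∩ E (k :: v)) ∪ (allChildren E v k ∩ (E (k :: v))ᶜ) := by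
  ext ω
  by_cases hk : ω ∈ E (k :: v)
  · simp only [allChildren, allButOneChild, Set.mem_ofPred_eq, Set.mem_inter_iff, Set.mem_union,
      Set.mem_compl_iff, hk, not_true, and_true, and_false, or_false]
    refine ⟨fun h i j hi hj => h i j (hi.trans k.lt_succ_self) (hj.trans k.lt_succ_self),
      fun h i j hi hj hij => ?_⟩
    rcases Nat.lt_succ_iff_lt_or_eq.1 hi with hi | rfl
    · rcases Nat.lt_succ_iff_lt_or_eq.1 hj with hj | rfl
      · exact h i j hi hj hij
      · exact Or.inr hk
    · exact Or.inl hk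
  · simp only [allChildren, allButOneChild, Set.mem_ofPred_eq, Set.mem_inter_iff, Set.mem_union,
      Set.mem_compl_iff, hk, not_false_iff, and_true, and_false, false_or]
    refine ⟨fun h i hi => (h i k (hi.trans k.lt_succ_self) k.lt_succ_self hi.ne).resolve_right hk,
      fun h i j hi hj hij => ?_⟩
    rcases Nat.lt_succ_iff_lt_or_eq.1 hi with hi | rfl
    · exact Or.inl (h i hi)
    · rcases Nat.lt_succ_iff_lt_or_eq.1 hj with hj | rfl
      · exact Or.inr (h j hj)
      · exact absurd rfl hij

variable {ξ : List ℕ → Ω → ℕ} {E : List ℕ → Set Ω}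

lemma measurableSet_allChildren
    (hE : ∀ u, MeasurableSet[offspringSigma ξ (descendants u)] (E u)) (v : List ℕ) (k : ℕ) :
    MeasurableSet[offspringSigma ξ (descendantsLT v k)] (allChildren E v k) := by
  induction k with
  | zero =>
    have : allChildren E v 0 = Set.univ := by ext; simp [allChildren]
    rw [this]
    exact @MeasurableSet.univ _ (offspringSigma ξ _)
  | succ k ih =>
    rw [allChildren_succ]
    exact @MeasurableSet.inter _ (offspringSigma ξ _) _ _
      (offspringSigma_mono ξ (descendantsLT_mono v k.le_succ) _ ih)
      (offspringSigma_mono ξ (descendants_child_subset v k.lt_succ_self) _ (hE _))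

lemma measurableSet_allButOneChild
    (hE : ∀ u, MeasurableSet[offspringSigma ξ (descendants u)] (E u)) (v : List ℕ) (k : ℕ) :
    MeasurableSet[offspringSigma ξ (descendantsLT v k)] (allButOneChild E v k) := by
  induction k with
  | zero =>
    have : allButOneChild E v 0 = Set.univ := by ext; simp [allButOneChild]
    rw [this]
    exact @MeasurableSet.univ _ (offspringSigma ξ _)
  | succ k ih =>
    rw [allButOneChild_succ]
    have hk := offspringSigma_mono ξ (descendants_child_subset v k.lt_succ_self) _ (hE (k :: v))
    have hm := offspringSigma_mono ξ (descendantsLT_mono v k.le_succ)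
    exact @MeasurableSet.union _ (offspringSigma ξ _) _ _
      (@MeasurableSet.inter _ (offspringSigma ξ _) _ _ (hm _ ih) hk)
      (@MeasurableSet.inter _ (offspringSigma ξ _) _ _
        (hm _ (measurableSet_allChildren hE v k)) (@MeasurableSet.compl _ _ (offspringSigma ξ _) hk))

lemma setOf_mem_offspring_eq_iUnion (ξ : List ℕ → Ω → ℕ) (v : List ℕ) (A : ℕ → Set Ω) :
    {ω | ω ∈ A (ξ v ω)} = ⋃ k, {ω | ξ v ω = k} ∩ A k := by
  ext ω
  simp

lemma measurableSet_mem_offspring {v : List ℕ} {A : ℕ → Set Ω}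
    (hA : ∀ k, MeasurableSet[offspringSigma ξ (descendantsLT v k)] (A k)) :
    MeasurableSet[offspringSigma ξ (descendants v)] {ω | ω ∈ A (ξ v ω)} := by
  rw [setOf_mem_offspring_eq_iUnion]
  refine @MeasurableSet.iUnion _ _ (offspringSigma ξ _) _ _ fun k =>
    @MeasurableSet.inter _ (offspringSigma ξ _) _ _ ?_ ?_
  · exact measurableSet_offspring_eq ξ (show v ∈ descendants v from List.suffix_rfl) k
  · exact offspringSigma_mono ξ
      ((descendantsLT_subset v k).trans (properDescendants_subset v)) _ (hA k)

/-- Keeping track of the σ-algebra of the descendants of `v` is what later yields independence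
between siblings. -/
lemma measurableSet_cutsWithin (ξ : List ℕ → Ω → ℕ) (n : ℕ) (v : List ℕ) :
    MeasurableSet[offspringSigma ξ (descendants v)] {ω | CutsWithin (fun v => ξ v ω) n v} := by
  induction n generalizing v with
  | zero => exact @MeasurableSet.empty _ (offspringSigma ξ _)
  | succ n ih => exact measurableSet_mem_offspring (measurableSet_allButOneChild ih v)

lemma measurableSet_diesWithin (ξ : List ℕ → Ω → ℕ) (n : ℕ) (v : List ℕ) :
    MeasurableSet[offspringSigma ξ (descendants v)] {ω | DiesWithin (fun v => ξ v ω) n v} := by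
  induction n generalizing v with
  | zero => exact @MeasurableSet.empty _ (offspringSigma ξ _)
  | succ n ih => exact measurableSet_mem_offspring (measurableSet_allChildren ih v)

/-- Breaker, moving first, wins the subtree of `v`. -/
def cutEvent (ξ : List ℕ → Ω → ℕ) (v : List ℕ) : Set Ω :=
  ⋃ n, {ω | CutsWithin (fun v => ξ v ω) n v}

/-- The descendants of `v` die out. -/
def extinctEvent (ξ : List ℕ → Ω → ℕ) (v : List ℕ) : Set Ω :=
  ⋃ n, {ω | DiesWithin (fun v => ξ v ω) n v}

lemma measurableSet_cutEvent (ξ : List ℕ → Ω → ℕ) (v : List ℕ) :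
    MeasurableSet[offspringSigma ξ (descendants v)] (cutEvent ξ v) :=
  @MeasurableSet.iUnion _ _ (offspringSigma ξ _) _ _ fun n => measurableSet_cutsWithin ξ n v

lemma measurableSet_extinctEvent (ξ : List ℕ → Ω → ℕ) (v : List ℕ) :
    MeasurableSet[offspringSigma ξ (descendants v)] (extinctEvent ξ v) :=
  @MeasurableSet.iUnion _ _ (offspringSigma ξ _) _ _ fun n => measurableSet_diesWithin ξ n v

/-- The recursion survives the union over all depths because `v` has finitely many children, which
share a common depth. -/
lemma cutEvent_eq (ξ : List ℕ → Ω → ℕ) (v : List ℕ) :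
    cutEvent ξ v = {ω | ω ∈ allButOneChild (cutEvent ξ) v (ξ v ω)} := by
  ext ω
  simp only [cutEvent, allButOneChild, Set.mem_iUnion, Set.mem_ofPred_eq]
  constructor
  · rintro ⟨n, hn⟩ i j hi hj hij
    exact (CutsWithin.succ hn i j hi hj hij).imp (fun h => ⟨n, h⟩) fun h => ⟨n, h⟩
  · intro h
    by_contra hB
    obtain ⟨i, j, hi, hj, hij, hBi, hBj⟩ := exists_two_children hB
    exact (h i j hi hj hij).elim hBi hBj

lemma breakerWinEvent_breaker (ξ : List ℕ → Ω → ℕ) :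
    breakerWinEvent ξ .breaker = cutEvent ξ [] := by
  ext ω
  simp only [breakerWinEvent, cutEvent, Set.mem_ofPred_eq, Set.mem_iUnion, breakerWins_breaker_iff]

lemma breakerWinEvent_maker (ξ : List ℕ → Ω → ℕ) :
    breakerWinEvent ξ .maker = {ω | ω ∈ allChildren (cutEvent ξ) [] (ξ [] ω)} := by
  ext ω
  simp only [breakerWinEvent, cutEvent, allChildren, Set.mem_ofPred_eq, Set.mem_iUnion,
    breakerWins_maker_iff]

lemma exists_common_dying (c : List ℕ → ℕ) (v : List ℕ) (k : ℕ)
    (h : ∀ i < k, ∃ n, DiesWithin c n (i :: v)) : ∃ N, ∀ i < k, DiesWithin c N (i :: v) := by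
  have hmono : ∀ u, Monotone fun n => DiesWithin c n u :=
    fun u => monotone_nat_of_le_succ fun _ => DiesWithin.succ
  choose! f hf using h
  exact ⟨(Finset.range k).sup f, fun i hi =>
    hmono _ (Finset.le_sup (Finset.mem_range.2 hi)) (hf i hi)⟩

lemma extinctEvent_eq (ξ : List ℕ → Ω → ℕ) (v : List ℕ) :
    extinctEvent ξ v = {ω | ω ∈ allChildren (extinctEvent ξ) v (ξ v ω)} := by
  ext ω
  simp only [extinctEvent, allChildren, Set.mem_iUnion, Set.mem_ofPred_eq]
  constructor
  · rintro ⟨n, hn⟩ i hi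
    exact ⟨n, DiesWithin.succ hn i hi⟩
  · intro h
    obtain ⟨N, hN⟩ := exists_common_dying _ v _ h
    exact ⟨N + 1, hN⟩

/-! ### Their probabilities -/

variable [MeasurableSpace Ω] {P : Measure Ω} {f : ℕ → ℝ}

lemma IsOffspringFamily.measureReal_inter (h : IsOffspringFamily P ξ f) {S T : Set (List ℕ)}
    (hST : Disjoint S T) {A B : Set Ω} (hA : MeasurableSet[offspringSigma ξ S] A)
    (hB : MeasurableSet[offspringSigma ξ T] B) : P.real (A ∩ B) = P.real A * P.real B := by
  have := indep_iSup_of_disjoint (fun w => (h.measurable w).comap_le) h.indep.iIndep hST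
  rw [Indep_iff] at this
  simp only [measureReal_def, this A B hA hB, ENNReal.toReal_mul]

lemma IsOffspringFamily.measurableSet_breakerWinEvent (h : IsOffspringFamily P ξ f)
    (first : Player) : MeasurableSet (breakerWinEvent ξ first) := by
  have hE := measurableSet_cutEvent ξ
  cases first with
  | breaker =>
    rw [breakerWinEvent_breaker]
    exact offspringSigma_le h.measurable _ _ (hE _)
  | maker =>
    rw [breakerWinEvent_maker]
    exact offspringSigma_le h.measurable _ _
      (measurableSet_mem_offspring (measurableSet_allChildren hE []))

variable [IsProbabilityMeasure P]

lemma IsOffspringFamily.measureReal_allChildren (h : IsOffspringFamily P ξ f)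
    (hE : ∀ u, MeasurableSet[offspringSigma ξ (descendants u)] (E u)) {x : ℝ}
    (hx : ∀ u, P.real (E u) = x) (v : List ℕ) (k : ℕ) :
    P.real (allChildren E v k) = x ^ k := by
  induction k with
  | zero =>
    have : allChildren E v 0 = Set.univ := by ext; simp [allChildren]
    simp [this]
  | succ k ih =>
    rw [allChildren_succ, h.measureReal_inter (disjoint_descendantsLT v k)
      (measurableSet_allChildren hE v k) (hE _), ih, hx, pow_succ]

/-- Binomial probability of at most one failure among `k` independent trials. For `k = 0` the
truncated exponent is harmless, its factor being `0`. -/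
lemma IsOffspringFamily.measureReal_allButOneChild (h : IsOffspringFamily P ξ f)
    (hE : ∀ u, MeasurableSet[offspringSigma ξ (descendants u)] (E u)) {x : ℝ}
    (hx : ∀ u, P.real (E u) = x) (v : List ℕ) (k : ℕ) :
    P.real (allButOneChild E v k) = x ^ k + k * x ^ (k - 1) * (1 - x) := by
  induction k with
  | zero =>
    have : allButOneChild E v 0 = Set.univ := by ext; simp [allButOneChild]
    simp [this]
  | succ k ih =>
    have hle := fun S => offspringSigma_le h.measurable S
    have hEk : MeasurableSet (E (k :: v)) := hle _ _ (hE _)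
    have hd : Disjoint (allButOneChild E v k ∩ E (k :: v))
        (allChildren E v k ∩ (E (k :: v))ᶜ) :=
      Set.disjoint_left.2 fun ω h1 h2 => h2.2 h1.2
    rw [allButOneChild_succ, measureReal_union hd
      ((hle _ _ (measurableSet_allChildren hE v k)).inter hEk.compl),
      h.measureReal_inter (disjoint_descendantsLT v k) (measurableSet_allButOneChild hE v k) (hE _),
      h.measureReal_inter (disjoint_descendantsLT v k) (measurableSet_allChildren hE v k)
        (@MeasurableSet.compl _ _ (offspringSigma ξ _) (hE _)),
      ih, h.measureReal_allChildren hE hx, probReal_compl_eq_one_sub hEk, hx]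
    cases k with
    | zero => simp
    | succ k =>
      simp only [Nat.add_sub_cancel]
      push_cast
      ring

/-- Conditioning on the offspring number of `v`, which is independent of everything strictly below
`v`. -/
lemma IsOffspringFamily.hasSum_mem_offspring (h : IsOffspringFamily P ξ f) {v : List ℕ}
    {A : ℕ → Set Ω} (hA : ∀ k, MeasurableSet[offspringSigma ξ (descendantsLT v k)] (A k)) :
    HasSum (fun k => f k * P.real (A k)) (P.real {ω | ω ∈ A (ξ v ω)}) := by
  have hle := fun S => offspringSigma_le h.measurable S
  have hm : ∀ k, MeasurableSet ({ω | ξ v ω = k} ∩ A k) := fun k =>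
    (h.measurable v (measurableSet_singleton k)).inter (hle _ _ (hA k))
  have hd : Pairwise (Function.onFun Disjoint fun k => {ω | ξ v ω = k} ∩ A k) := by
    intro k l hkl
    refine Set.disjoint_left.2 ?_
    rintro ω ⟨h1, -⟩ ⟨h2, -⟩
    exact hkl (h1.symm.trans h2)
  have hk : ∀ k, f k * P.real (A k) = P.real ({ω | ξ v ω = k} ∩ A k) := by
    intro k
    rw [h.measureReal_inter (disjoint_singleton_properDescendants v)
      (measurableSet_offspring_eq ξ (Set.mem_singleton v) k)
      (offspringSigma_mono ξ (descendantsLT_subset v k) _ (hA k)), h.law]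
  rw [funext hk, setOf_mem_offspring_eq_iUnion]
  simp only [measureReal_def]
  rw [measure_iUnion hd hm, ENNReal.tsum_toReal_eq fun k => measure_ne_top _ _]
  refine ENNReal.hasSum_toReal ?_
  rw [← measure_iUnion hd hm]
  exact measure_ne_top _ _

lemma tendsto_measureReal_cutEvent (ξ : List ℕ → Ω → ℕ) (v : List ℕ) :
    Tendsto (fun n => P.real {ω | CutsWithin (fun v => ξ v ω) n v}) atTop
      (𝓝 (P.real (cutEvent ξ v))) :=
  (ENNReal.tendsto_toReal (measure_ne_top _ _)).comp
    (tendsto_measure_iUnion_atTop fun _ _ hmn _ hω => cutsWithin_mono _ v hmn hω)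

lemma tendsto_measureReal_extinctEvent (ξ : List ℕ → Ω → ℕ) (v : List ℕ) :
    Tendsto (fun n => P.real {ω | DiesWithin (fun v => ξ v ω) n v}) atTop
      (𝓝 (P.real (extinctEvent ξ v))) :=
  (ENNReal.tendsto_toReal (measure_ne_top _ _)).comp
    (tendsto_measure_iUnion_atTop (monotone_nat_of_le_succ fun _ _ hω => DiesWithin.succ hω))

/-- The probability that Breaker, moving first, wins is a fixed point of the recursion, and the
least one. -/
lemma IsOffspringFamily.measureReal_cutEvent (h : IsOffspringFamily P ξ f) {G : ℝ → ℝ}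
    (hG : ∀ x ∈ Set.Icc (0 : ℝ) 1,
      HasSum (fun k => f k * (x ^ k + k * x ^ (k - 1) * (1 - x))) (G x))
    (hmono : MonotoneOn G (Set.Icc 0 1)) :
    ∃ p ∈ Set.Icc (0 : ℝ) 1, (∀ v, P.real (cutEvent ξ v) = p) ∧ G p = p ∧
      ∀ y ∈ Set.Icc (0 : ℝ) 1, G y = y → p ≤ y := by
  -- The probabilities for depth `n` are the iterates of `G` from `0`; monotonicity keeps them below
  -- every fixed point.
  have hstep : ∀ n, ∃ x ∈ Set.Icc (0 : ℝ) 1,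
      (∀ v, P.real {ω | CutsWithin (fun v => ξ v ω) n v} = x) ∧
      ∀ y ∈ Set.Icc (0 : ℝ) 1, G y = y → x ≤ y := by
    intro n
    induction n with
    | zero => exact ⟨0, by simp, fun v => by simp [CutsWithin], fun y hy _ => hy.1⟩
    | succ n ih =>
      obtain ⟨x, hx, hxv, hxy⟩ := ih
      have hv : ∀ v, P.real {ω | CutsWithin (fun v => ξ v ω) (n + 1) v} = G x := by
        intro v
        have hE := measurableSet_cutsWithin ξ n
        have := h.hasSum_mem_offspring (measurableSet_allButOneChild hE v)
        simp only [h.measureReal_allButOneChild hE hxv] at this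
        exact this.unique (hG x hx)
      refine ⟨G x, ?_, hv, fun y hy hGy => ?_⟩
      · rw [← hv []]
        exact ⟨measureReal_nonneg, measureReal_le_one⟩
      · rw [← hGy]
        exact hmono hx hy (hxy y hy hGy)
  choose x _ hxv hxy using hstep
  have hlim : ∀ v, Tendsto x atTop (𝓝 (P.real (cutEvent ξ v))) := by
    intro v
    have := tendsto_measureReal_cutEvent (P := P) ξ v
    simp only [hxv] at this
    exact this
  have hv : ∀ v, P.real (cutEvent ξ v) = P.real (cutEvent ξ []) :=
    fun v => tendsto_nhds_unique (hlim v) (hlim [])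
  refine ⟨P.real (cutEvent ξ []), ⟨measureReal_nonneg, measureReal_le_one⟩, hv, ?_,
    fun y hy hGy => le_of_tendsto' (hlim []) fun n => hxy n y hy hGy⟩
  -- The one-step formula applied to the limit event itself gives the fixed-point equation, without
  -- continuity of `G`.
  have hE := measurableSet_cutEvent ξ
  have := h.hasSum_mem_offspring (measurableSet_allButOneChild hE [])
  simp only [h.measureReal_allButOneChild hE hv] at this
  rw [← cutEvent_eq] at this
  exact (hG _ ⟨measureReal_nonneg, measureReal_le_one⟩).unique this

/-- The extinction probability is the least fixed point of the generating function. -/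
lemma IsOffspringFamily.measureReal_extinctEvent (h : IsOffspringFamily P ξ f) {F : ℝ → ℝ}
    (hF : ∀ x ∈ Set.Icc (0 : ℝ) 1, HasSum (fun k => f k * x ^ k) (F x))
    (hmono : MonotoneOn F (Set.Icc 0 1)) :
    ∃ q ∈ Set.Icc (0 : ℝ) 1, (∀ v, P.real (extinctEvent ξ v) = q) ∧ F q = q ∧
      ∀ y ∈ Set.Icc (0 : ℝ) 1, F y = y → q ≤ y := by
  have hstep : ∀ n, ∃ x ∈ Set.Icc (0 : ℝ) 1,
      (∀ v, P.real {ω | DiesWithin (fun v => ξ v ω) n v} = x) ∧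
      ∀ y ∈ Set.Icc (0 : ℝ) 1, F y = y → x ≤ y := by
    intro n
    induction n with
    | zero => exact ⟨0, by simp, fun v => by simp [DiesWithin], fun y hy _ => hy.1⟩
    | succ n ih =>
      obtain ⟨x, hx, hxv, hxy⟩ := ih
      have hv : ∀ v, P.real {ω | DiesWithin (fun v => ξ v ω) (n + 1) v} = F x := by
        intro v
        have hE := measurableSet_diesWithin ξ n
        have := h.hasSum_mem_offspring (measurableSet_allChildren hE v)
        simp only [h.measureReal_allChildren hE hxv] at this
        exact this.unique (hF x hx)
      refine ⟨F x, ?_, hv, fun y hy hFy => ?_⟩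
      · rw [← hv []]
        exact ⟨measureReal_nonneg, measureReal_le_one⟩
      · rw [← hFy]
        exact hmono hx hy (hxy y hy hFy)
  choose x _ hxv hxy using hstep
  have hlim : ∀ v, Tendsto x atTop (𝓝 (P.real (extinctEvent ξ v))) := by
    intro v
    have := tendsto_measureReal_extinctEvent (P := P) ξ v
    simp only [hxv] at this
    exact this
  have hv : ∀ v, P.real (extinctEvent ξ v) = P.real (extinctEvent ξ []) :=
    fun v => tendsto_nhds_unique (hlim v) (hlim [])
  refine ⟨P.real (extinctEvent ξ []), ⟨measureReal_nonneg, measureReal_le_one⟩, hv, ?_,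
    fun y hy hFy => le_of_tendsto' (hlim []) fun n => hxy n y hy hFy⟩
  have hE := measurableSet_extinctEvent ξ
  have := h.hasSum_mem_offspring (measurableSet_allChildren hE [])
  simp only [h.measureReal_allChildren hE hv] at this
  rw [← extinctEvent_eq] at this
  exact (hF _ ⟨measureReal_nonneg, measureReal_le_one⟩).unique this

lemma IsOffspringFamily.measureReal_breakerWinEvent_maker (h : IsOffspringFamily P ξ f) {p y : ℝ}
    (hp : ∀ v, P.real (cutEvent ξ v) = p) (hF : HasSum (fun k => f k * p ^ k) y) :
    P.real (breakerWinEvent ξ .maker) = y := by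
  have hE := measurableSet_cutEvent ξ
  have := h.hasSum_mem_offspring (measurableSet_allChildren hE [])
  simp only [h.measureReal_allChildren hE hp] at this
  rw [breakerWinEvent_maker]
  exact this.unique hF

end Events

/-! ### Distributions with a geometric tail -/

section Geometric

variable {f : ℕ → ℝ} {a b r : ℝ}

/-- A free mass at `0` followed by a geometric tail covers both laws: `r = 1 - s`, with `(a, b) =
(0, s)` or `(s, s(1-s))`. -/
lemma hasSum_generating (h0 : f 0 = a) (hf : ∀ k, f (k + 1) = b * r ^ k) (hr0 : 0 ≤ r)
    (hr1 : r < 1) {x : ℝ} (hx : x ∈ Set.Icc (0 : ℝ) 1) :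
    HasSum (fun k => f k * x ^ k) (a + b * x / (1 - r * x)) := by
  have hrx : ‖r * x‖ < 1 := by
    rw [Real.norm_of_nonneg (mul_nonneg hr0 hx.1)]
    nlinarith [hx.1, hx.2]
  have key := (hasSum_geometric_of_norm_lt_one hrx).mul_left (b * x)
  have h1 : HasSum (fun k => f (k + 1) * x ^ (k + 1)) (b * x / (1 - r * x)) := by
    rw [div_eq_mul_inv]
    refine key.congr_fun fun k => ?_
    rw [hf]; ring
  have := (hasSum_nat_add_iff (f := fun k => f k * x ^ k) 1).1 h1
  simpa [h0, add_comm] using this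

lemma hasSum_recursion (h0 : f 0 = a) (hf : ∀ k, f (k + 1) = b * r ^ k) (hr0 : 0 ≤ r)
    (hr1 : r < 1) {x : ℝ} (hx : x ∈ Set.Icc (0 : ℝ) 1) :
    HasSum (fun k : ℕ => f k * (x ^ k + k * x ^ (k - 1) * (1 - x)))
      (a + b * (1 - r * x ^ 2) / (1 - r * x) ^ 2) := by
  have hlt : r * x < 1 := by nlinarith [hx.1, hx.2]
  have hrx : ‖r * x‖ < 1 := by
    rwa [Real.norm_of_nonneg (mul_nonneg hr0 hx.1)]
  have hD : 1 - r * x ≠ 0 := by linarith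
  have k1 := hasSum_geometric_of_norm_lt_one hrx
  have k2 := hasSum_coe_mul_geometric_of_norm_lt_one hrx
  -- Uses `x^(k+1) + (k+1) x^k (1-x) = x^k + k x^k (1-x)`.
  have key := (k1.mul_left b).add (k2.mul_left (b * (1 - x)))
  have h1 : HasSum (fun k : ℕ => f (k + 1) *
      (x ^ (k + 1) + (k + 1 : ℕ) * x ^ (k + 1 - 1) * (1 - x)))
      (b * (1 - r * x ^ 2) / (1 - r * x) ^ 2) := by
    have hv : b * (1 - r * x ^ 2) / (1 - r * x) ^ 2 =
        b * (1 - r * x)⁻¹ + b * (1 - x) * (r * x / (1 - r * x) ^ 2) := by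
      field_simp
      ring
    rw [hv]
    refine key.congr_fun fun k => ?_
    rw [hf, Nat.add_sub_cancel]
    push_cast
    ring
  have := (hasSum_nat_add_iff
    (f := fun k : ℕ => f k * (x ^ k + k * x ^ (k - 1) * (1 - x))) 1).1 h1
  simpa [h0, add_comm] using this

lemma monotoneOn_generating (hb : 0 ≤ b) (hr0 : 0 ≤ r) (hr1 : r < 1) :
    MonotoneOn (fun x => a + b * x / (1 - r * x)) (Set.Icc 0 1) := by
  intro x hx y hy hxy
  have h1 : 0 < 1 - r * x := by nlinarith [hx.1, hx.2]
  have h2 : 0 < 1 - r * y := by nlinarith [hy.1, hy.2]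
  have : b * x / (1 - r * x) ≤ b * y / (1 - r * y) := by
    rw [div_le_div_iff₀ h1 h2]
    nlinarith [mul_le_mul_of_nonneg_left hxy hb]
  simpa using this

lemma monotoneOn_recursion (hb : 0 ≤ b) (hr0 : 0 ≤ r) (hr1 : r < 1) :
    MonotoneOn (fun x => a + b * (1 - r * x ^ 2) / (1 - r * x) ^ 2) (Set.Icc 0 1) := by
  intro x hx y hy hxy
  have h1 : 0 < 1 - r * x := by nlinarith [hx.1, hx.2]
  have h2 : 0 < 1 - r * y := by nlinarith [hy.1, hy.2]
  -- After cross-multiplication the difference of the two values is `b r (y - x)` times this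
  -- expression.
  have h3 : 0 ≤ (1 - x) * (1 - r * y) + (1 - y) * (1 - r * x) :=
    add_nonneg (mul_nonneg (by linarith [hx.2]) h2.le) (mul_nonneg (by linarith [hy.2]) h1.le)
  have h4 := mul_nonneg (mul_nonneg hb (mul_nonneg hr0 (sub_nonneg.2 hxy))) h3
  have : b * (1 - r * x ^ 2) / (1 - r * x) ^ 2 ≤ b * (1 - r * y ^ 2) / (1 - r * y) ^ 2 := by
    rw [div_le_div_iff₀ (pow_pos h1 2) (pow_pos h2 2)]
    linarith
  simpa using this

variable {Ω : Type*} [MeasurableSpace Ω] {P : Measure Ω} [IsProbabilityMeasure P]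
  {ξ : List ℕ → Ω → ℕ}

lemma IsOffspringFamily.breakerWin_of_geometric (h : IsOffspringFamily P ξ f) (h0 : f 0 = a)
    (hf : ∀ k, f (k + 1) = b * r ^ k) (hb : 0 ≤ b) (hr0 : 0 ≤ r) (hr1 : r < 1) :
    P.real (breakerWinEvent ξ .breaker) ∈ Set.Icc (0 : ℝ) 1 ∧
    (P.real (breakerWinEvent ξ .breaker) - a) * (1 - r * P.real (breakerWinEvent ξ .breaker)) ^ 2 =
      b * (1 - r * P.real (breakerWinEvent ξ .breaker) ^ 2) ∧
    (∀ y ∈ Set.Icc (0 : ℝ) 1, (y - a) * (1 - r * y) ^ 2 = b * (1 - r * y ^ 2) →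
      P.real (breakerWinEvent ξ .breaker) ≤ y) ∧
    P.real (breakerWinEvent ξ .maker) =
      a + b * P.real (breakerWinEvent ξ .breaker) /
        (1 - r * P.real (breakerWinEvent ξ .breaker)) := by
  obtain ⟨p, hp, hpv, hpG, hpy⟩ := h.measureReal_cutEvent
    (fun x hx => hasSum_recursion h0 hf hr0 hr1 hx) (monotoneOn_recursion hb hr0 hr1)
  have hpos : ∀ y ∈ Set.Icc (0 : ℝ) 1, (1 - r * y) ^ 2 ≠ 0 := fun y hy =>
    pow_ne_zero 2 (by nlinarith [hy.1, hy.2])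
  rw [breakerWinEvent_breaker, hpv]
  refine ⟨hp, ?_, fun y hy hGy => hpy y hy ?_, ?_⟩
  · rw [← eq_div_iff (hpos p hp)]
    linarith
  · rw [← eq_div_iff (hpos y hy)] at hGy
    linarith
  · exact h.measureReal_breakerWinEvent_maker hpv (hasSum_generating h0 hf hr0 hr1 hp)

lemma IsOffspringFamily.extinction_of_geometric (h : IsOffspringFamily P ξ f) (h0 : f 0 = a)
    (hf : ∀ k, f (k + 1) = b * r ^ k) (hb : 0 ≤ b) (hr0 : 0 ≤ r) (hr1 : r < 1) :
    ∃ q ∈ Set.Icc (0 : ℝ) 1,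
      Tendsto (fun n : ℕ => P.real {ω | generationSize (fun v => ξ v ω) n = 0}) atTop (𝓝 q) ∧
      (q - a) * (1 - r * q) = b * q ∧
      ∀ y ∈ Set.Icc (0 : ℝ) 1, (y - a) * (1 - r * y) = b * y → q ≤ y := by
  obtain ⟨q, hq, hqv, hqF, hqy⟩ := h.measureReal_extinctEvent
    (fun x hx => hasSum_generating h0 hf hr0 hr1 hx) (monotoneOn_generating hb hr0 hr1)
  have hpos : ∀ y ∈ Set.Icc (0 : ℝ) 1, 1 - r * y ≠ 0 := fun y hy => by nlinarith [hy.1, hy.2]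
  refine ⟨q, hq, ?_, ?_, fun y hy hFy => hqy y hy ?_⟩
  · simp only [generationSize_eq_zero_iff]
    exact hqv [] ▸ tendsto_measureReal_extinctEvent ξ []
  · rw [← eq_div_iff (hpos q hq)]
    linarith
  · rw [← eq_div_iff (hpos y hy)] at hFy
    linarith

end Geometric

/-! ### Roots of the cubic fixed-point equations -/

/-- The least solution of the recursion for the distribution `geoPos s`. -/
lemma geoPos_fixedPoint {s p : ℝ} (hs0 : 0 < s) (hs : s ≤ 1 / 4)
    (hfix : (p - 0) * (1 - (1 - s) * p) ^ 2 = s * (1 - (1 - s) * p ^ 2))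
    (hmin : ∀ y ∈ Set.Icc (0 : ℝ) 1,
      (y - 0) * (1 - (1 - s) * y) ^ 2 = s * (1 - (1 - s) * y ^ 2) → p ≤ y) :
    p = (1 - √(1 - 4 * s)) / (2 * (1 - s)) := by
  have ht : √(1 - 4 * s) ^ 2 = 1 - 4 * s := Real.sq_sqrt (by linarith)
  have ht0 := Real.sqrt_nonneg (1 - 4 * s)
  set t := √(1 - 4 * s)
  have hr : 0 < 2 * (1 - s) := by linarith
  set y := (1 - t) / (2 * (1 - s)) with hy
  have hyt : 2 * (1 - s) * y = 1 - t := by rw [hy, mul_comm, div_mul_cancel₀ _ hr.ne']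
  have hquad : (1 - s) ^ 2 * y ^ 2 - (1 - s) * y + s = 0 := by
    linear_combination (1 / 4) * (2 * (1 - s) * y - 1 - t) * hyt + (1 / 4) * ht
  have ht1 : t ≤ 1 := by nlinarith
  have hyI : y ∈ Set.Icc (0 : ℝ) 1 := by
    constructor
    · rw [hy]; exact div_nonneg (by linarith) hr.le
    · rw [hy, div_le_one hr]; nlinarith
  -- The cubic is `y - 1` times the quadratic in `hquad`.
  have hle : p ≤ y := hmin y hyI (by linear_combination (y - 1) * hquad)
  have hprod : (p - 1) * (((1 - s) * p - (1 + t) / 2) * ((1 - s) * p - (1 - t) / 2)) = 0 := by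
    linear_combination hfix - (1 / 4) * (p - 1) * ht
  -- Each of the three roots is at least `y`, so `p ≤ y` leaves only `p = y`.
  rcases mul_eq_zero.1 hprod with h | h
  · linarith [hyI.2]
  · have hpy : 2 * (1 - s) * y ≤ 2 * (1 - s) * p := by
      rcases mul_eq_zero.1 h with h | h <;> linarith
    exact le_antisymm hle (le_of_mul_le_mul_left hpy hr)

/-- The least solution of the recursion for the distribution `geoZero s`. -/
lemma geoZero_fixedPoint {s p : ℝ} (hs0 : 0 < s) (hs : s ≤ 1 / 5)
    (hfix : (p - s) * (1 - (1 - s) * p) ^ 2 = s * (1 - s) * (1 - (1 - s) * p ^ 2))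
    (hmin : ∀ y ∈ Set.Icc (0 : ℝ) 1,
      (y - s) * (1 - (1 - s) * y) ^ 2 = s * (1 - s) * (1 - (1 - s) * y ^ 2) → p ≤ y) :
    p = (1 + s - √((1 - s) * (1 - 5 * s))) / (2 * (1 - s)) := by
  have ht : √((1 - s) * (1 - 5 * s)) ^ 2 = (1 - s) * (1 - 5 * s) :=
    Real.sq_sqrt (mul_nonneg (by linarith) (by linarith))
  have ht0 := Real.sqrt_nonneg ((1 - s) * (1 - 5 * s))
  set t := √((1 - s) * (1 - 5 * s))
  have hr : 0 < 2 * (1 - s) := by linarith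
  set y := (1 + s - t) / (2 * (1 - s)) with hy
  have hyt : 2 * (1 - s) * y = 1 + s - t := by rw [hy, mul_comm, div_mul_cancel₀ _ hr.ne']
  have hquad : (1 - s) ^ 2 * y ^ 2 - (1 - s) * (1 + s) * y + s * (2 - s) = 0 := by
    linear_combination (1 / 4) * (2 * (1 - s) * y - (1 + s) - t) * hyt + (1 / 4) * ht
  have ht1 : t ≤ 1 := by nlinarith
  have hyI : y ∈ Set.Icc (0 : ℝ) 1 := by
    constructor
    · rw [hy]; exact div_nonneg (by linarith) hr.le
    · rw [hy, div_le_one hr]; nlinarith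
  have hle : p ≤ y := hmin y hyI (by linear_combination (y - 1) * hquad)
  have hprod : (p - 1) * (((1 - s) * p - (1 + s + t) / 2) * ((1 - s) * p - (1 + s - t) / 2)) =
      0 := by
    linear_combination hfix - (1 / 4) * (p - 1) * ht
  rcases mul_eq_zero.1 hprod with h | h
  · linarith [hyI.2]
  · have hpy : 2 * (1 - s) * y ≤ 2 * (1 - s) * p := by
      rcases mul_eq_zero.1 h with h | h <;> linarith
    exact le_antisymm hle (le_of_mul_le_mul_left hpy hr)

/-- Completing the square shows that the quadratic factor is positive, leaving only the root `1`. -/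
lemma geoPos_fixedPoint_eq_one {s p : ℝ} (hs : 1 / 4 < s)
    (hfix : (p - 0) * (1 - (1 - s) * p) ^ 2 = s * (1 - (1 - s) * p ^ 2)) : p = 1 := by
  have h : (p - 1) * (((1 - s) * p - 1 / 2) ^ 2 + (s - 1 / 4)) = 0 := by
    linear_combination hfix
  rcases mul_eq_zero.1 h with h | h
  · linarith
  · nlinarith [sq_nonneg ((1 - s) * p - 1 / 2)]

lemma geoZero_fixedPoint_eq_one {s p : ℝ} (hs : 1 / 5 < s) (hs1 : s ≤ 1)
    (hfix : (p - s) * (1 - (1 - s) * p) ^ 2 = s * (1 - s) * (1 - (1 - s) * p ^ 2)) : p = 1 := by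
  -- At `s = 1` the positive constant of the completed square vanishes, but the equation itself then
  -- reads `p - 1 = 0`.
  rcases hs1.eq_or_lt with rfl | hs1
  · linarith
  · have h : (p - 1) * (((1 - s) * p - (1 + s) / 2) ^ 2 + (1 - s) * (5 * s - 1) / 4) = 0 := by
      linear_combination hfix
    rcases mul_eq_zero.1 h with h | h
    · linarith
    · have : 0 < (1 - s) * (5 * s - 1) := mul_pos (by linarith) (by linarith)
      nlinarith [sq_nonneg ((1 - s) * p - (1 + s) / 2)]

end MakerBreaker

/-! ### The two geometric laws -/

theorem proposition4p4 {Ω : Type*} [MeasurableSpace Ω] (P : Measure Ω) [IsProbabilityMeasure P]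
    (ξ : List ℕ → Ω → ℕ) (s : ℝ) (hs0 : 0 < s) (hs1 : s ≤ 1)
    (p pbar : ℝ)
    (hp : p = P.real (MakerBreaker.breakerWinEvent ξ MakerBreaker.Player.breaker))
    (hpbar : pbar = P.real (MakerBreaker.breakerWinEvent ξ MakerBreaker.Player.maker)) :
    (MakerBreaker.IsOffspringFamily P ξ (MakerBreaker.geoPos s) →
      (∀ first, MeasurableSet (MakerBreaker.breakerWinEvent ξ first)) ∧
      (s ≤ 1 / 4 →
        p = (1 - √(1 - 4 * s)) / (2 * (1 - s)) ∧
        pbar = (1 - 2 * s - √(1 - 4 * s)) / (2 * (1 - s)) ∧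
        pbar = p - s / (1 - s)) ∧
      (1 / 4 < s → p = 1 ∧ pbar = 1)) ∧
    (MakerBreaker.IsOffspringFamily P ξ (MakerBreaker.geoZero s) →
      (∀ first, MeasurableSet (MakerBreaker.breakerWinEvent ξ first)) ∧
      (s ≤ 1 / 5 →
        p = (1 + s - √((1 - s) * (1 - 5 * s))) / (2 * (1 - s)) ∧
        pbar = (1 - s - √((1 - s) * (1 - 5 * s))) / (2 * (1 - s)) ∧
        ∃ q : ℝ,
          Tendsto
            (fun n : ℕ => P.real {ω | MakerBreaker.generationSize (fun v => ξ v ω) n = 0})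
            atTop (𝓝 q) ∧
          pbar = p - q) ∧
      (1 / 5 < s → p = 1 ∧ pbar = 1)) := by
  open MakerBreaker in
  have hr0 : 0 ≤ 1 - s := by linarith
  have hr1 : 1 - s < 1 := by linarith
  refine ⟨fun h => ?_, fun h => ?_⟩
  · obtain ⟨-, hfix, hmin, hmaker⟩ := h.breakerWin_of_geometric (a := 0) (b := s) (r := 1 - s)
      (by simp [geoPos]) (fun k => by simp [geoPos]) hs0.le hr0 hr1
    rw [← hp] at hfix hmin hmaker
    rw [← hpbar] at hmaker
    refine ⟨h.measurableSet_breakerWinEvent, fun hs => ?_, fun hs => ?_⟩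
    · have hp' := geoPos_fixedPoint hs0 hs hfix hmin
      have hr : 0 < 1 - s := by linarith
      -- With denominators cleared, this is again the quadratic satisfied by `p`.
      have hbar : pbar = p - s / (1 - s) := by
        have ht : √(1 - 4 * s) ^ 2 = 1 - 4 * s := Real.sq_sqrt (by linarith)
        have ht0 := Real.sqrt_nonneg (1 - 4 * s)
        have hpt : 2 * (1 - s) * p = 1 - √(1 - 4 * s) := by rw [hp']; field_simp
        have hD : 1 - (1 - s) * p ≠ 0 := by linarith
        rw [hmaker, zero_add, div_eq_iff hD]
        field_simp
        linear_combination (1 / 4) * (2 * (1 - s) * p - 1 - √(1 - 4 * s)) * hpt + (1 / 4) * ht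
      refine ⟨hp', ?_, hbar⟩
      rw [hbar, hp']
      field_simp
      ring
    · have hp1 := geoPos_fixedPoint_eq_one hs hfix
      refine ⟨hp1, ?_⟩
      rw [hmaker, hp1, show 1 - (1 - s) * 1 = s by ring]
      field_simp
      ring
  · have hb : 0 ≤ s * (1 - s) := mul_nonneg hs0.le hr0
    have h0 : geoZero s 0 = s := by simp [geoZero]
    have hk : ∀ k, geoZero s (k + 1) = s * (1 - s) * (1 - s) ^ k := fun k => by
      simp only [geoZero]; ring
    obtain ⟨-, hfix, hmin, hmaker⟩ := h.breakerWin_of_geometric h0 hk hb hr0 hr1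
    rw [← hp] at hfix hmin hmaker
    rw [← hpbar] at hmaker
    refine ⟨h.measurableSet_breakerWinEvent, fun hs => ?_, fun hs => ?_⟩
    · have hp' := geoZero_fixedPoint hs0 hs hfix hmin
      have hr : 0 < 1 - s := by linarith
      have hbar : pbar = p - s / (1 - s) := by
        have ht : √((1 - s) * (1 - 5 * s)) ^ 2 = (1 - s) * (1 - 5 * s) :=
          Real.sq_sqrt (mul_nonneg (by linarith) (by linarith))
        have ht0 := Real.sqrt_nonneg ((1 - s) * (1 - 5 * s))
        have hpt : 2 * (1 - s) * p = 1 + s - √((1 - s) * (1 - 5 * s)) := by rw [hp']; field_simp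
        have hD : 1 - (1 - s) * p ≠ 0 := by linarith
        have hm : pbar = s / (1 - (1 - s) * p) := by
          rw [hmaker]
          field_simp
          ring
        rw [hm, div_eq_iff hD]
        field_simp
        linear_combination (1 / 4) * (2 * (1 - s) * p - (1 + s) - √((1 - s) * (1 - 5 * s))) * hpt
          + (1 / 4) * ht
      obtain ⟨q, hqI, hq, hqfix, hqmin⟩ := h.extinction_of_geometric h0 hk hb hr0 hr1
      -- The extinction equation has the roots `1` and `s / (1 - s)`; the latter is at most `1`
      -- here, so it is the least.
      have hqs : q = s / (1 - s) := by
        have hle : q ≤ s / (1 - s) := by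
          refine hqmin _ ⟨by positivity, ?_⟩ ?_
          · rw [div_le_one hr]; linarith
          · field_simp
            ring
        have hprod : (q - 1) * ((1 - s) * q - s) = 0 := by linear_combination -hqfix
        rcases mul_eq_zero.1 hprod with h | h
        · have : s / (1 - s) ≤ 1 := by rw [div_le_one hr]; linarith
          linarith
        · rw [eq_div_iff hr.ne']; linarith
      refine ⟨hp', ?_, q, hq, hqs ▸ hbar⟩
      rw [hbar, hp']
      field_simp
      ring
    · have hp1 := geoZero_fixedPoint_eq_one hs hs1 hfix
      refine ⟨hp1, ?_⟩
      rw [hmaker, hp1, show 1 - (1 - s) * 1 = s by ring]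
      field_simp
      ring
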